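/- All graphs are finite and simple. For a graph $H$, let $p_2(H)$ be the minimum size $k$ of a path odd-cover of $H$, i.e. of a collection of $k$ paths in the complete graph on $V(H)$ such that the edges of $H$ are exactly the pairs of vertices that are edges of an odd number of these paths. A subdivision of $G$ is a graph obtained, up to isomorphism, from $G$ by finitely many (possibly zero) steps, each of which replaces an edge $uv$ by a path $uwv$ through a new vertex $w$. Let $v_{\mathrm{odd}}(G)$ be the number of vertices of odd degree and $\Delta(G)$ the maximum degree of $G$. Theorem. Suppose that $G$, after deletion of its isolated vertices, is not the disjoint union of at least one cycle with at most one path. Then $$\min\{\,p_2(H) : H \text{ is a subdivision of } G\,\} = \max\left\{\frac{v_{\mathrm{odd}}(G)}{2},\ \left\lceil \frac{\Delta(G)}{2}\right\rceil\right\}.$$ -/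

import Mathlib

universe u

/-- A path of the complete graph on the vertex set `V` (single vertices are allowed). -/
structure CompletePath (V : Type u) where
  fst : V
  lst : V
  walk : (⊤ : SimpleGraph V).Walk fst lst
  isPath : walk.IsPath

/-- The family `P` of paths in the complete graph on `V` is a path odd-cover of `G`: the edges of
`G` are exactly the pairs that are edges of an odd number of the paths. -/
def IsPathOddCover {V : Type u} (G : SimpleGraph V) {k : ℕ} (P : Fin k → CompletePath V) : Prop :=
  ∀ e : Sym2 V, e ∈ G.edgeSet ↔ Odd (Set.ncard {i : Fin k | e ∈ (P i).walk.edges})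

/-- The path odd-cover number `p₂(G)`: the least number of paths in a path odd-cover of `G`
(for a finite graph there is always one, see `exists_isPathOddCover`). -/
noncomputable def pathOddCoverNumber {V : Type u} (G : SimpleGraph V) : ℕ :=
  sInf {k : ℕ | ∃ P : Fin k → CompletePath V, IsPathOddCover G P}

theorem exists_isPathOddCover {V : Type u} [Finite V] (G : SimpleGraph V) :
    ∃ (k : ℕ) (P : Fin k → CompletePath V), IsPathOddCover G P := by
  classical
  have : ∀ e : G.edgeSet, ∃ P : CompletePath V, ∀ e', e' ∈ P.walk.edges ↔ e' = e.1 := by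
    rintro ⟨e, he⟩
    induction e using Sym2.ind with
    | h a b =>
      have hab : (⊤ : SimpleGraph V).Adj a b := (G.mem_edgeSet.1 he).ne
      exact ⟨⟨a, b, hab.toWalk, SimpleGraph.Walk.IsPath.of_adj hab⟩, fun e' => by simp⟩
  choose P hP using this
  obtain ⟨k, ⟨f⟩⟩ := Finite.exists_equiv_fin G.edgeSet
  refine ⟨k, fun i => P (f.symm i), fun e => ?_⟩
  simp only [hP]
  by_cases he : e ∈ G.edgeSet
  · have h1 : {i : Fin k | e = (f.symm i).1} = {f ⟨e, he⟩} := by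
      ext i
      simp only [Set.mem_ofPred_eq, Set.mem_singleton_iff]
      constructor
      · intro h
        exact (f.symm_apply_eq.1 (Subtype.ext h.symm))
      · rintro rfl
        simp
    simp [h1, he]
  · have h1 : {i : Fin k | e = (f.symm i).1} = ∅ := by
      ext i
      simp only [Set.mem_ofPred_eq, Set.mem_empty_iff_false, iff_false]
      intro h
      exact he (h ▸ (f.symm i).2)
    simp [h1, he]

/-- Subdivide the edge `uv` of `G` once: delete `uv`, and join the new vertex `none` to exactly
`u` and `v`. -/
def subdivideEdge {V : Type u} (G : SimpleGraph V) (u v : V) : SimpleGraph (Option V) where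
  Adj
    | some a, some b => G.Adj a b ∧ s(a, b) ≠ s(u, v)
    | none, some b => b = u ∨ b = v
    | some a, none => a = u ∨ a = v
    | none, none => False
  symm := ⟨by
    rintro (_ | a) (_ | b) h
    · exact h
    · exact h
    · exact h
    · exact ⟨h.1.symm, by rw [Sym2.eq_swap]; exact h.2⟩⟩
  loopless := ⟨by
    rintro (_ | a) h
    · exact h
    · exact h.1.ne rfl⟩

/-- `IsSubdivision G H`: up to isomorphism, `H` is obtained from `G` by subdividing edges,
finitely many times (possibly none). -/
inductive IsSubdivision {V : Type u} (G : SimpleGraph V) :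
    {W : Type u} → SimpleGraph W → Prop
  | refl : IsSubdivision G G
  | subdivide {W : Type u} {H : SimpleGraph W} {u v : W} :
      IsSubdivision G H → H.Adj u v → IsSubdivision G (subdivideEdge H u v)
  | iso {W W' : Type u} {H : SimpleGraph W} {H' : SimpleGraph W'} :
      IsSubdivision G H → (H ≃g H') → IsSubdivision G H'

/-- The component `c` is a cycle. -/
def IsCycleComponent {V : Type u} {G : SimpleGraph V} (c : G.ConnectedComponent) : Prop :=
  ∃ (v : V) (p : G.Walk v v), p.IsCycle ∧ p.toSubgraph = (⊤ : G.Subgraph).induce c.supp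

/-- The component `c` is a path, possibly a single vertex. -/
def IsPathComponent {V : Type u} {G : SimpleGraph V} (c : G.ConnectedComponent) : Prop :=
  ∃ (v w : V) (p : G.Walk v w), p.IsPath ∧ p.toSubgraph = (⊤ : G.Subgraph).induce c.supp

/-- Apart from isolated vertices, `G` is the disjoint union of at least one cycle with at most
one path: some component is a cycle, every component is a cycle or a path, and at most one
of the path components has more than one vertex. -/
def IsCyclesWithAtMostOnePath {V : Type u} (G : SimpleGraph V) : Prop :=
  (∃ c : G.ConnectedComponent, IsCycleComponent c) ∧
  (∀ c : G.ConnectedComponent, IsCycleComponent c ∨ IsPathComponent c) ∧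
  {c : G.ConnectedComponent | IsPathComponent c ∧ c.supp.Nontrivial}.Subsingleton

/-- The number of vertices of odd degree. -/
def oddDegreeCount {V : Type u} [Fintype V] (G : SimpleGraph V) [DecidableRel G.Adj] : ℕ :=
  (Finset.univ.filter fun v : V => Odd (G.degree v)).card

/-! Lower bound: a subdivision keeps old degrees and adds only vertices of degree 2. In a cover by
`k` paths each path contributes at most 2 to a degree, and an odd vertex must be an end of some path
(`bounds_of_isPathOddCover`).

Upper bound, with `k` the claimed maximum: join a new apex to all odd vertices. The resulting even
graph splits into cycles, and deleting the apex leaves half as many paths as odd vertices, together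
with cycles. Each vertex lies on half its degree, rounded up, of these members, hence on at most `k`
(`exists_path_cycle_decomposition`). Without cycles this is already a cover. With a cycle and `k ≤
1` the members are disjoint and at most one is a path, which is the excluded case.

For `k ≥ 2` the number of paths is raised to exactly `k` by cutting at subdivision vertices, and the
cycles are then absorbed one at a time. A non-edge traversed twice cancels modulo 2, so walks may
jump between subdivision vertices if each jump is made in pairs. If a cycle meets a chosen path at
`v`, then `v` is on the cycle and on at most `k` members, so one of the `k` paths misses `v`; that
path takes `v` over from the cycle by a detour (`Ledger.detour`). Once the cycle is disjoint from
the chosen path, this path and a second one absorb it (`exists_absorb_of_disjoint`). No move raises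
the multiplicity of an old vertex, and a new vertex has multiplicity at most `2 ≤ k`, so the bound
persists. -/

/-! ### Walks covering a subdivision modulo 2, with multiplicities -/

section Ledger

variable {V U : Type u}

/-- The edges joining consecutive entries of a list. -/
def pathEdges : List U → Multiset (Sym2 U)
  | [] => 0
  | [_] => 0
  | a :: b :: l => s(a, b) ::ₘ pathEdges (b :: l)

/-- The edges of the closed walk through the entries of a list. -/
def cycleEdges : List U → Multiset (Sym2 U)
  | [] => 0
  | a :: l => pathEdges (a :: l ++ [a])

@[simp] theorem pathEdges_nil : pathEdges ([] : List U) = 0 := rfl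
@[simp] theorem pathEdges_singleton (a : U) : pathEdges [a] = 0 := rfl
@[simp] theorem pathEdges_cons_cons (a b : U) (l : List U) :
    pathEdges (a :: b :: l) = s(a, b) ::ₘ pathEdges (b :: l) := rfl

theorem pathEdges_append_cons (A : List U) (a : U) (B : List U) :
    pathEdges (A ++ a :: B) = pathEdges (A ++ [a]) + pathEdges (a :: B) := by
  induction A with
  | nil => simp
  | cons x A ih =>
    cases A with
    | nil => simp
    | cons y A => simp only [List.cons_append, pathEdges_cons_cons] at ih ⊢; rw [ih, Multiset.cons_add]

theorem pathEdges_append_cons_cons (A : List U) (a b : U) (B : List U) :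
    pathEdges (A ++ a :: b :: B) =
      s(a, b) ::ₘ (pathEdges (A ++ [a]) + pathEdges (b :: B)) := by
  rw [pathEdges_append_cons, pathEdges_cons_cons, Multiset.add_cons]

theorem exists_eq_append_of_mem_pathEdges {e : Sym2 U} : ∀ {l : List U}, e ∈ pathEdges l →
    ∃ A a b B, l = A ++ a :: b :: B ∧ e = s(a, b)
  | [], h => by simp at h
  | [_], h => by simp at h
  | a :: b :: l, h => by
    rw [pathEdges_cons_cons, Multiset.mem_cons] at h
    rcases h with rfl | h
    · exact ⟨[], a, b, l, rfl, rfl⟩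
    · obtain ⟨A, x, y, B, h1, h2⟩ := exists_eq_append_of_mem_pathEdges h
      exact ⟨a :: A, x, y, B, by simp [h1], h2⟩

theorem mem_of_mem_pathEdges {e : Sym2 U} {l : List U} (h : e ∈ pathEdges l) {v : U} (hv : v ∈ e) :
    v ∈ l := by
  obtain ⟨A, a, b, B, rfl, rfl⟩ := exists_eq_append_of_mem_pathEdges h
  rcases Sym2.mem_iff.1 hv with rfl | rfl <;> simp

/-- The graph on the vertex set `X` with edges prescribed by `h`. -/
def graphOn (X : Set U) (h : Set (Sym2 U)) : SimpleGraph X where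
  Adj a b := a ≠ b ∧ s((a : U), (b : U)) ∈ h
  symm := ⟨fun a b H => ⟨H.1.symm, by rw [Sym2.eq_swap]; exact H.2⟩⟩
  loopless := ⟨fun _ H => H.1 rfl⟩

theorem isSubdivision_graphOn_insert {G : SimpleGraph V} {X : Set U} {h : Set (Sym2 U)}
    (hX : ∀ e ∈ h, ∀ v ∈ e, v ∈ X) (hS : IsSubdivision G (graphOn X h)) {a b z : U}
    (hab : s(a, b) ∈ h) (hne : a ≠ b) (hz : z ∉ X) :
    IsSubdivision G (graphOn (insert z X)
      (insert s(a, z) (insert s(z, b) (h \ {s(a, b)})))) := by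
  classical
  have ha : a ∈ X := hX _ hab a (by simp)
  have hb : b ∈ X := hX _ hab b (by simp)
  have hadj : (graphOn X h).Adj ⟨a, ha⟩ ⟨b, hb⟩ := ⟨by simpa using hne, hab⟩
  let f : Option X → (insert z X : Set U) := fun o => o.elim ⟨z, by simp⟩ fun x => ⟨x, by simp⟩
  have hf : Function.Bijective f := by
    constructor
    · rintro (_ | x) (_ | y) hxy
      · rfl
      · exact absurd (congrArg Subtype.val hxy) (fun h' : z = y => hz (h' ▸ y.2))
      · exact absurd (congrArg Subtype.val hxy) (fun h' : (x : U) = z => hz (h' ▸ x.2))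
      · exact congrArg some (Subtype.ext (congrArg (fun y : (insert z X : Set U) => (y : U)) hxy))
    · rintro ⟨y, rfl | hy⟩
      · exact ⟨none, rfl⟩
      · exact ⟨some ⟨y, hy⟩, rfl⟩
  refine IsSubdivision.iso (IsSubdivision.subdivide hS hadj)
    ⟨Equiv.ofBijective f hf, ?_⟩
  have key : ∀ y ∈ X, s(z, y) ∉ h := fun y _ h' => hz (hX _ h' z (by simp))
  have hne' : ∀ y ∈ X, y ≠ z := fun y hy h' => hz (h' ▸ hy)
  rintro (_ | ⟨x, hx⟩) (_ | ⟨y, hy⟩)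
  · simp [f, subdivideEdge]
  · have := key y hy; have := hne' y hy; have := hne' a ha; have := hne' b hb
    simp [f, subdivideEdge, graphOn]
    grind
  · have := key x hx; have := hne' x hx; have := hne' a ha; have := hne' b hb
    simp [f, subdivideEdge, graphOn]
    grind [Sym2.eq_swap]
  · have := hne' x hx; have := hne' y hy
    simp [f, subdivideEdge, graphOn]
    grind

variable [DecidableEq U]

/-- Bookkeeping for a family of walks in the complete graph on `X` with edges `E` and
vertices `T` which together cover, modulo 2, a subdivision of `G` with edge set `h`. -/
structure Ledger (G : SimpleGraph V) (k : ℕ) (X : Set U) (h : Set (Sym2 U))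
    (E : Multiset (Sym2 U)) (T : Multiset U) : Prop where
  isSubdivision : IsSubdivision G (graphOn X h)
  finite : X.Finite
  mem_of_mem_edges : ∀ e ∈ E, ∀ v ∈ e, v ∈ X
  mem_of_mem_verts : ∀ v ∈ T, v ∈ X
  not_isDiag : ∀ e ∈ h, ¬ e.IsDiag
  count_eq_one : ∀ e ∈ h, E.count e = 1
  even_count : ∀ e ∉ h, Even (E.count e)
  count_le : ∀ v, T.count v ≤ k

variable {G : SimpleGraph V} {k : ℕ} {X : Set U} {h : Set (Sym2 U)}
  {E : Multiset (Sym2 U)} {T : Multiset U}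

theorem Ledger.mem_edges (L : Ledger G k X h E T) {e : Sym2 U} (he : e ∈ h) : e ∈ E :=
  Multiset.count_pos.1 (by rw [L.count_eq_one e he]; exact one_pos)

theorem Ledger.congr (L : Ledger G k X h E T) {E' : Multiset (Sym2 U)} (hE : E = E') :
    Ledger G k X h E' T := hE ▸ L

theorem Ledger.mono (L : Ledger G k X h E T) {T' : Multiset U} (hT : T' ≤ T) :
    Ledger G k X h E T' where
  __ := L
  mem_of_mem_verts v hv := L.mem_of_mem_verts v (Multiset.mem_of_le hT hv)
  count_le v := (Multiset.count_le_of_le v hT).trans (L.count_le v)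

/-- Two traversals of a non-edge cancel modulo 2. -/
theorem Ledger.jump (L : Ledger G k X h E T) {u w : U} (hu : u ∈ X) (hw : w ∈ X)
    (huw : s(u, w) ∉ h) : Ledger G k X h (s(u, w) ::ₘ s(u, w) ::ₘ E) T where
  __ := L
  mem_of_mem_edges e he v hv := by
    simp only [Multiset.mem_cons] at he
    rcases he with rfl | rfl | he
    · rcases Sym2.mem_iff.1 hv with rfl | rfl <;> assumption
    · rcases Sym2.mem_iff.1 hv with rfl | rfl <;> assumption
    · exact L.mem_of_mem_edges e he v hv
  count_eq_one e he := by
    have : e ≠ s(u, w) := fun h' => huw (h' ▸ he)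
    simp [this, L.count_eq_one e he]
  even_count e he := by
    have := L.even_count e he
    simp only [Multiset.count_cons]
    split_ifs <;> grind

/-- The new vertex `z` subdivides the edge `ab`; the other edges in `E` persist. -/
structure Fresh (X : Set U) (h h' : Set (Sym2 U)) (E : Multiset (Sym2 U)) (a b z : U) : Prop where
  notMem : z ∉ X
  left : s(a, z) ∈ h'
  right : s(z, b) ∈ h'
  mem_of_mem : ∀ e ∈ E, e ∈ h → e ∈ h'
  notMem_of_ne : ∀ w, w ≠ a → w ≠ b → s(w, z) ∉ h'

/-- Since `s(a, b)` occurs exactly once in all, replacing that one occurrence by two edges through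
`z` accounts for the subdivision. The vertex `z` is charged twice: one visit lies on the subdivided
walk, the other is held in reserve for a second walk. This is where `2 ≤ k` enters. -/
theorem Ledger.subdivide [Infinite U] (hk : 2 ≤ k) {a b : U}
    (L : Ledger G k X h (s(a, b) ::ₘ E) T) (hab : s(a, b) ∈ h) :
    ∃ z h', Ledger G k (insert z X) h' (s(a, z) ::ₘ s(z, b) ::ₘ E) (z ::ₘ z ::ₘ T) ∧
      Fresh X h h' E a b z := by
  obtain ⟨z, hz⟩ := L.finite.exists_notMem
  have hX : ∀ e ∈ h, ∀ v ∈ e, v ∈ X := fun e he => L.mem_of_mem_edges e (L.mem_edges he)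
  have hne : a ≠ b := by simpa using L.not_isDiag _ hab
  have ha : a ∈ X := hX _ hab a (by simp)
  have hb : b ∈ X := hX _ hab b (by simp)
  have haz : a ≠ z := fun h' => hz (h' ▸ ha)
  have hbz : b ≠ z := fun h' => hz (h' ▸ hb)
  have hzE : ∀ e ∈ E, z ∉ e := fun e he h' =>
    hz (L.mem_of_mem_edges e (Multiset.mem_cons_of_mem he) z h')
  have hzh : ∀ e ∈ h, z ∉ e := fun e he h' => hz (hX e he z h')
  have habE : s(a, b) ∉ E := by
    have := L.count_eq_one _ hab
    rw [Multiset.count_cons_self] at this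
    exact Multiset.count_eq_zero.1 (by omega)
  have hzT : z ∉ T := fun h' => hz (L.mem_of_mem_verts z h')
  have hsz : s(a, z) ≠ s(z, b) := by
    intro h'
    rcases Sym2.eq_iff.1 h' with ⟨h1, -⟩ | ⟨h1, -⟩
    · exact haz h1
    · exact hne h1
  refine ⟨z, _, ⟨isSubdivision_graphOn_insert hX L.isSubdivision hab hne hz, L.finite.insert z,
    ?_, ?_, ?_, ?_, ?_, ?_⟩, hz, by simp, by simp, ?_, ?_⟩
  · intro e he v hv
    simp only [Multiset.mem_cons] at he
    rcases he with rfl | rfl | he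
    · rcases Sym2.mem_iff.1 hv with rfl | rfl <;> simp [ha]
    · rcases Sym2.mem_iff.1 hv with rfl | rfl <;> simp [hb]
    · exact Or.inr (L.mem_of_mem_edges e (Multiset.mem_cons_of_mem he) v hv)
  · intro v hv
    simp only [Multiset.mem_cons] at hv
    rcases hv with rfl | rfl | hv
    · simp
    · simp
    · exact Or.inr (L.mem_of_mem_verts v hv)
  · rintro e (rfl | rfl | he)
    · simpa using haz
    · simpa using hbz.symm
    · exact L.not_isDiag e he.1
  · rintro e (rfl | rfl | ⟨he, he'⟩)
    · have : s(a, z) ∉ E := fun h' => hzE _ h' (by simp)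
      simp [hsz, this]
    · have : s(z, b) ∉ E := fun h' => hzE _ h' (by simp)
      simp [hsz.symm, this]
    · have h1 : e ≠ s(a, z) := fun h' => hzh e he (by simp [h'])
      have h2 : e ≠ s(z, b) := fun h' => hzh e he (by simp [h'])
      have h3 : e ≠ s(a, b) := he'
      have := L.count_eq_one e he
      simp_all
  · intro e he
    have h1 : e ≠ s(a, z) := fun h' => he (by simp [h'])
    have h2 : e ≠ s(z, b) := fun h' => he (by simp [h'])
    by_cases h3 : e = s(a, b)
    · subst h3
      simp [h1, h2, habE]
    · have := L.even_count e (fun h' => he (by simp [h', h3]))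
      simp_all
  · intro v
    have := L.count_le v
    by_cases hv : v = z
    · subst hv
      simp [hzT, hk]
    · simpa [hv] using this
  · intro e he he'
    have h3 : e ≠ s(a, b) := fun h' => habE (h' ▸ he)
    simp [he', h3]
  · rintro w hwa hwb (h' | h' | h')
    · grind [Sym2.eq_iff]
    · grind [Sym2.eq_iff]
    · exact hzh _ h'.1 (by simp)

end Ledger

/-! ### Families of paths and cycles: cutting a path, absorbing a disjoint cycle -/

section Config

variable {V U : Type u}

/-- All edges of a family `Q` of paths and a family `C` of cycles. -/
def totalEdges (Q C : Multiset (List U)) : Multiset (Sym2 U) :=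
  (Q.map pathEdges).sum + (C.map cycleEdges).sum

/-- All vertices of a family `Q` of paths and a family `C` of cycles. -/
def totalVerts (Q C : Multiset (List U)) : Multiset U :=
  (Q.map Multiset.ofList).sum + (C.map Multiset.ofList).sum

@[simp] theorem totalEdges_cons_path (p : List U) (Q C : Multiset (List U)) :
    totalEdges (p ::ₘ Q) C = pathEdges p + totalEdges Q C := by
  simp [totalEdges, add_assoc]

@[simp] theorem totalEdges_cons_cycle (c : List U) (Q C : Multiset (List U)) :
    totalEdges Q (c ::ₘ C) = cycleEdges c + totalEdges Q C := by
  simp [totalEdges, add_left_comm]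

@[simp] theorem totalVerts_cons_path (p : List U) (Q C : Multiset (List U)) :
    totalVerts (p ::ₘ Q) C = (p : Multiset U) + totalVerts Q C := by
  simp [totalVerts, add_assoc]

@[simp] theorem totalVerts_cons_cycle (c : List U) (Q C : Multiset (List U)) :
    totalVerts Q (c ::ₘ C) = (c : Multiset U) + totalVerts Q C := by
  simp [totalVerts, add_left_comm]

/-- `Q` consists of paths containing an edge of `h`, and `C` of cycles with all edges in `h`. -/
structure Admissible (h : Set (Sym2 U)) (Q C : Multiset (List U)) : Prop where
  path_nodup : ∀ p ∈ Q, p.Nodup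
  path_edge : ∀ p ∈ Q, ∃ e ∈ pathEdges p, e ∈ h
  cycle_nodup : ∀ c ∈ C, c.Nodup
  cycle_ne_nil : ∀ c ∈ C, c ≠ []
  cycle_edge : ∀ c ∈ C, ∀ e ∈ cycleEdges c, e ∈ h

variable {h h' : Set (Sym2 U)} {Q C : Multiset (List U)}

theorem Admissible.of_cons_path {p : List U} (R : Admissible h (p ::ₘ Q) C) :
    Admissible h Q C where
  __ := R
  path_nodup q hq := R.path_nodup q (Multiset.mem_cons_of_mem hq)
  path_edge q hq := R.path_edge q (Multiset.mem_cons_of_mem hq)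

theorem Admissible.of_cons_cycle {c : List U} (R : Admissible h Q (c ::ₘ C)) :
    Admissible h Q C where
  __ := R
  cycle_nodup q hq := R.cycle_nodup q (Multiset.mem_cons_of_mem hq)
  cycle_ne_nil q hq := R.cycle_ne_nil q (Multiset.mem_cons_of_mem hq)
  cycle_edge q hq := R.cycle_edge q (Multiset.mem_cons_of_mem hq)

theorem Admissible.cons_path {p : List U} (R : Admissible h Q C) (hp : p.Nodup) {e : Sym2 U}
    (he : e ∈ pathEdges p) (heh : e ∈ h) : Admissible h (p ::ₘ Q) C where
  __ := R
  path_nodup q hq := by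
    rcases Multiset.mem_cons.1 hq with rfl | hq
    · exact hp
    · exact R.path_nodup q hq
  path_edge q hq := by
    rcases Multiset.mem_cons.1 hq with rfl | hq
    · exact ⟨e, he, heh⟩
    · exact R.path_edge q hq

theorem pathEdges_le_totalEdges {p : List U} (hp : p ∈ Q) : pathEdges p ≤ totalEdges Q C := by
  obtain ⟨Q, rfl⟩ := Multiset.exists_cons_of_mem hp
  rw [totalEdges_cons_path]
  exact Multiset.le_add_right _ _

theorem cycleEdges_le_totalEdges {c : List U} (hc : c ∈ C) : cycleEdges c ≤ totalEdges Q C := by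
  obtain ⟨C, rfl⟩ := Multiset.exists_cons_of_mem hc
  rw [totalEdges_cons_cycle]
  exact Multiset.le_add_right _ _

theorem Admissible.mono (R : Admissible h Q C) (H : ∀ e ∈ totalEdges Q C, e ∈ h → e ∈ h') :
    Admissible h' Q C where
  __ := R
  path_edge p hp := by
    obtain ⟨e, he, heh⟩ := R.path_edge p hp
    exact ⟨e, he, H e (Multiset.mem_of_le (pathEdges_le_totalEdges hp) he) heh⟩
  cycle_edge c hc e he :=
    H e (Multiset.mem_of_le (cycleEdges_le_totalEdges hc) he) (R.cycle_edge c hc e he)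

theorem mem_totalVerts_of_mem {p : List U} (hp : p ∈ Q) {v : U} (hv : v ∈ p) :
    v ∈ totalVerts Q C := by
  obtain ⟨Q, rfl⟩ := Multiset.exists_cons_of_mem hp
  simp [hv]

variable [DecidableEq U] {G : SimpleGraph V} {k : ℕ} {X : Set U}

/-- Cut the path at a vertex subdividing one of its edges in `h`. Both pieces contain `z`, using up
its two visits, and each keeps one half of the subdivided edge, so each can be cut again. -/
theorem exists_split [Infinite U] (hk : 2 ≤ k) {p : List U}
    (L : Ledger G k X h (totalEdges (p ::ₘ Q) C) (totalVerts (p ::ₘ Q) C))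
    (R : Admissible h (p ::ₘ Q) C) :
    ∃ (X' : Set U) (h' : Set (Sym2 U)) (p' p'' : List U),
      Ledger G k X' h' (totalEdges (p' ::ₘ p'' ::ₘ Q) C) (totalVerts (p' ::ₘ p'' ::ₘ Q) C) ∧
      Admissible h' (p' ::ₘ p'' ::ₘ Q) C := by
  obtain ⟨e, he, heh⟩ := R.path_edge p (by simp)
  obtain ⟨A, a, b, B, rfl, rfl⟩ := exists_eq_append_of_mem_pathEdges he
  have hpX : ∀ v ∈ A ++ a :: b :: B, v ∈ X := fun v hv =>
    L.mem_of_mem_verts v (mem_totalVerts_of_mem (by simp) hv)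
  have hp := R.path_nodup (A ++ a :: b :: B) (by simp)
  rw [totalEdges_cons_path, pathEdges_append_cons_cons, Multiset.cons_add] at L
  obtain ⟨z, h', L', F⟩ := L.subdivide hk heh
  have hz : z ∉ A ++ a :: b :: B := fun hz => F.notMem (hpX z hz)
  refine ⟨insert z X, h', A ++ [a, z], z :: b :: B, ?_, ?_⟩
  · convert L' using 1
    · simp only [totalEdges_cons_path, pathEdges_append_cons_cons, pathEdges_cons_cons,
        pathEdges_singleton]
      simp only [← Multiset.singleton_add]
      abel
    · simp only [totalVerts_cons_path, ← Multiset.coe_add, ← Multiset.cons_coe, Multiset.coe_nil]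
      simp only [← Multiset.singleton_add]
      abel
  · refine Admissible.cons_path (Admissible.cons_path (R.of_cons_path.mono fun e he heh =>
      F.mem_of_mem e (by simp [he]) heh) ?_ (e := s(z, b)) (by simp) F.right) ?_ (e := s(a, z))
      (by simp [pathEdges_append_cons_cons]) F.left
    · grind
    · grind

-- The equation `hD` describes one nonempty list by its last entry `d` and by its first entry `f`; a
-- cycle opened at its closing edge `df` is handled in this form throughout.
omit [DecidableEq U] in
theorem pathEdges_cons_append {D F : List U} {d f : U} (hD : D ++ [d] = f :: F) (y : U)
    (Y : List U) : pathEdges (y :: (D ++ d :: Y)) = s(y, f) ::ₘ pathEdges (D ++ d :: Y) := by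
  have : D ++ d :: Y = f :: (F ++ Y) := by
    rw [← List.cons_append, ← hD]; simp
  rw [this, pathEdges_cons_cons]

/-- The edge and vertex account for absorbing a cycle: `ab` and `cg` come from two paths, `df` from
the cycle. Each is subdivided twice, and three jumps, each made twice, connect the new vertices. -/
theorem Ledger.reroute [Infinite U] (hk : 2 ≤ k) {E : Multiset (Sym2 U)} {T : Multiset U}
    {a b c g d f : U} (L : Ledger G k X h (s(a, b) ::ₘ s(c, g) ::ₘ s(d, f) ::ₘ E) T)
    (hab : s(a, b) ∈ h) (hcg : s(c, g) ∈ h) (hdf : s(d, f) ∈ h) :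
    ∃ x₁ x₂ z₁ z₂ y₁ y₂ X' h', Ledger G k X' h'
      (s(a, x₁) ::ₘ s(x₁, x₂) ::ₘ s(x₂, b) ::ₘ s(c, z₁) ::ₘ s(z₁, z₂) ::ₘ s(z₂, g) ::ₘ
        s(d, y₂) ::ₘ s(y₂, y₁) ::ₘ s(y₁, f) ::ₘ s(x₁, z₁) ::ₘ s(x₁, z₁) ::ₘ
        s(x₂, y₂) ::ₘ s(x₂, y₂) ::ₘ s(z₂, y₁) ::ₘ s(z₂, y₁) ::ₘ E)
      (x₁ ::ₘ x₁ ::ₘ x₂ ::ₘ x₂ ::ₘ z₁ ::ₘ z₁ ::ₘ z₂ ::ₘ z₂ ::ₘ y₁ ::ₘ y₁ ::ₘ y₂ ::ₘ y₂ ::ₘ T) ∧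
      [x₁, x₂, z₁, z₂, y₁, y₂].Nodup ∧ (∀ v ∈ [x₁, x₂, z₁, z₂, y₁, y₂], v ∉ X) ∧
      s(a, x₁) ∈ h' ∧ s(c, z₁) ∈ h' ∧ ∀ e ∈ E, e ∈ h → e ∈ h' := by
  have haX : a ∈ X := L.mem_of_mem_edges s(a, b) (by simp) a (by simp)
  have hbX : b ∈ X := L.mem_of_mem_edges s(a, b) (by simp) b (by simp)
  have hcX : c ∈ X := L.mem_of_mem_edges s(c, g) (by simp) c (by simp)
  have hgX : g ∈ X := L.mem_of_mem_edges s(c, g) (by simp) g (by simp)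
  have hdX : d ∈ X := L.mem_of_mem_edges s(d, f) (by simp) d (by simp)
  have hfX : f ∈ X := L.mem_of_mem_edges s(d, f) (by simp) f (by simp)
  obtain ⟨x₁, h₁, L₁, F₁⟩ := L.subdivide hk hab
  obtain ⟨x₂, h₂, L₂, F₂⟩ := (L₁.congr (Multiset.cons_swap _ _ _)).subdivide hk F₁.right
  obtain ⟨z₁, h₃, L₃, F₃⟩ := (L₂.congr (E' := s(c, g) ::ₘ s(x₁, x₂) ::ₘ s(x₂, b) ::ₘ s(a, x₁) ::ₘ
    s(d, f) ::ₘ E) (by simp only [← Multiset.singleton_add]; abel)).subdivide hk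
    (F₂.mem_of_mem _ (by simp) (F₁.mem_of_mem _ (by simp) hcg))
  have n₁ := F₁.notMem
  have n₂ := F₂.notMem
  have n₃ := F₃.notMem
  -- The jump is entered as soon as `z₁` exists, when its only neighbours are `c` and `g`. The other
  -- two jumps follow the same pattern.
  have L₃' := L₃.jump (u := x₁) (w := z₁) (by simp) (by simp)
    (F₃.notMem_of_ne x₁ (by rintro rfl; exact n₁ hcX) (by rintro rfl; exact n₁ hgX))
  obtain ⟨z₂, h₄, L₄, F₄⟩ := (L₃'.congr (E' := s(z₁, g) ::ₘ s(c, z₁) ::ₘ s(x₁, x₂) ::ₘ s(x₂, b) ::ₘ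
    s(a, x₁) ::ₘ s(d, f) ::ₘ s(x₁, z₁) ::ₘ s(x₁, z₁) ::ₘ E)
    (by simp only [← Multiset.singleton_add]; abel)).subdivide hk F₃.right
  obtain ⟨y₂, h₅, L₅, F₅⟩ := (L₄.congr (E' := s(d, f) ::ₘ s(z₁, z₂) ::ₘ s(z₂, g) ::ₘ s(c, z₁) ::ₘ
    s(x₁, x₂) ::ₘ s(x₂, b) ::ₘ s(a, x₁) ::ₘ s(x₁, z₁) ::ₘ s(x₁, z₁) ::ₘ E)
    (by simp only [← Multiset.singleton_add]; abel)).subdivide hk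
    (F₄.mem_of_mem _ (by simp) (F₃.mem_of_mem _ (by simp) (F₂.mem_of_mem _ (by simp)
      (F₁.mem_of_mem _ (by simp) hdf))))
  have n₄ := F₄.notMem
  have n₅ := F₅.notMem
  have L₅' := L₅.jump (u := x₂) (w := y₂) (by simp) (by simp)
    (F₅.notMem_of_ne x₂ (by rintro rfl; exact n₂ (by simp [hdX]))
      (by rintro rfl; exact n₂ (by simp [hfX])))
  obtain ⟨y₁, h₆, L₆, F₆⟩ := (L₅'.congr (E' := s(y₂, f) ::ₘ s(d, y₂) ::ₘ s(z₁, z₂) ::ₘ s(z₂, g) ::ₘ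
    s(c, z₁) ::ₘ s(x₁, x₂) ::ₘ s(x₂, b) ::ₘ s(a, x₁) ::ₘ s(x₁, z₁) ::ₘ s(x₁, z₁) ::ₘ
    s(x₂, y₂) ::ₘ s(x₂, y₂) ::ₘ E)
    (by simp only [← Multiset.singleton_add]; abel)).subdivide hk F₅.right
  have n₆ := F₆.notMem
  have L₆' := L₆.jump (u := z₂) (w := y₁) (by simp) (by simp)
    (F₆.notMem_of_ne z₂ (by rintro rfl; exact n₅ (by simp))
      (by rintro rfl; exact n₄ (by simp [hfX])))
  refine ⟨x₁, x₂, z₁, z₂, y₁, y₂, insert y₁ (insert y₂ (insert z₂ (insert z₁ (insert x₂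
    (insert x₁ X))))), h₆, ?_, ?_, ?_, ?_, ?_, ?_⟩
  · convert L₆' using 1
    · simp only [← Multiset.singleton_add]
      abel
    · simp only [← Multiset.singleton_add]
      abel
  · simp only [Set.mem_insert_iff, not_or] at n₁ n₂ n₃ n₄ n₅ n₆
    simp only [List.nodup_cons, List.mem_cons, List.not_mem_nil, or_false, not_or, not_false_eq_true,
      List.nodup_nil, and_true]
    grind
  · simp only [Set.mem_insert_iff, not_or] at n₁ n₂ n₃ n₄ n₅ n₆
    simp only [List.mem_cons, List.not_mem_nil, or_false]
    grind
  · exact F₆.mem_of_mem _ (by simp) (F₅.mem_of_mem _ (by simp) (F₄.mem_of_mem _ (by simp)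
      (F₃.mem_of_mem _ (by simp) (F₂.mem_of_mem _ (by simp) F₁.left))))
  · exact F₆.mem_of_mem _ (by simp) (F₅.mem_of_mem _ (by simp) (F₄.mem_of_mem _ (by simp) F₃.left))
  · intro e he heh
    exact F₆.mem_of_mem _ (by simp [he]) (F₅.mem_of_mem _ (by simp [he]) (F₄.mem_of_mem _
      (by simp [he]) (F₃.mem_of_mem _ (by simp [he]) (F₂.mem_of_mem _ (by simp [he])
      (F₁.mem_of_mem _ (by simp [he]) heh)))))

/-- The first path can run through all of the cycle because they are disjoint. The second path need
not avoid the cycle, since it visits only new vertices. -/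
theorem exists_absorb_of_disjoint [Infinite U] (hk : 2 ≤ k) {p₁ p₂ D F : List U} {d f : U}
    (hD : D ++ [d] = f :: F)
    (L : Ledger G k X h (pathEdges (D ++ [d, f]) + totalEdges (p₁ ::ₘ p₂ ::ₘ Q) C)
      ((D ++ [d] : List U) + totalVerts (p₁ ::ₘ p₂ ::ₘ Q) C))
    (R : Admissible h (p₁ ::ₘ p₂ ::ₘ Q) C) (hdf : s(d, f) ∈ h) (hnd : (D ++ [d]).Nodup)
    (hdisj : ∀ v ∈ D ++ [d], v ∉ p₁) :
    ∃ (X' : Set U) (h' : Set (Sym2 U)) (p₁' p₂' : List U),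
      Ledger G k X' h' (totalEdges (p₁' ::ₘ p₂' ::ₘ Q) C) (totalVerts (p₁' ::ₘ p₂' ::ₘ Q) C) ∧
      Admissible h' (p₁' ::ₘ p₂' ::ₘ Q) C := by
  obtain ⟨e, he, hab⟩ := R.path_edge p₁ (by simp)
  obtain ⟨A, a, b, B, rfl, rfl⟩ := exists_eq_append_of_mem_pathEdges he
  obtain ⟨e, he, hcg⟩ := R.path_edge p₂ (by simp)
  obtain ⟨A', c, g, B', rfl, rfl⟩ := exists_eq_append_of_mem_pathEdges he
  have hp₁X : ∀ v ∈ A ++ a :: b :: B, v ∈ X := fun v hv =>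
    L.mem_of_mem_verts v (Multiset.mem_add.2 (Or.inr (mem_totalVerts_of_mem (by simp) hv)))
  have hp₂X : ∀ v ∈ A' ++ c :: g :: B', v ∈ X := fun v hv =>
    L.mem_of_mem_verts v (Multiset.mem_add.2 (Or.inr (mem_totalVerts_of_mem (by simp) hv)))
  have hDX : ∀ v ∈ D ++ [d], v ∈ X := fun v hv =>
    L.mem_of_mem_verts v (Multiset.mem_add.2 (Or.inl hv))
  have hp₁ := R.path_nodup (A ++ a :: b :: B) (by simp)
  have hp₂ := R.path_nodup (A' ++ c :: g :: B') (by simp)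
  obtain ⟨E, hE⟩ : ∃ E, E = pathEdges (D ++ [d]) + (pathEdges (A ++ [a]) +
    pathEdges (b :: B)) + (pathEdges (A' ++ [c]) + pathEdges (g :: B')) + totalEdges Q C := ⟨_, rfl⟩
  obtain ⟨x₁, x₂, z₁, z₂, y₁, y₂, X', h', L', hN, hX', hax, hcz, hh'⟩ := (L.congr
    (E' := s(a, b) ::ₘ s(c, g) ::ₘ s(d, f) ::ₘ E) (by
      simp only [totalEdges_cons_path, pathEdges_append_cons_cons, hE, pathEdges_singleton]
      simp only [← Multiset.singleton_add]
      abel)).reroute hk hab hcg hdf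
  -- The first path borrows `z₁z₂`, enters the cycle at `f` and leaves it at `d`. The second takes
  -- the segments `x₁x₂` and `y₂y₁` that the first omits. The jumps `x₁z₁`, `x₂y₂`, `z₂y₁` lie on
  -- both and cancel.
  refine ⟨X', h', A ++ a :: x₁ :: z₁ :: z₂ :: y₁ :: (D ++ d :: y₂ :: x₂ :: b :: B),
    A' ++ c :: z₁ :: x₁ :: x₂ :: y₂ :: y₁ :: z₂ :: g :: B', ?_, ?_⟩
  · convert L' using 1
    · simp only [totalEdges_cons_path, pathEdges_append_cons_cons, pathEdges_cons_cons,
        pathEdges_cons_append hD, hE]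
      rw [Sym2.eq_swap (a := y₂) (b := x₂), Sym2.eq_swap (a := z₁) (b := x₁),
        Sym2.eq_swap (a := y₁) (b := z₂)]
      simp only [← Multiset.singleton_add]
      abel
    · simp only [totalVerts_cons_path, ← Multiset.coe_add, ← Multiset.cons_coe, Multiset.coe_nil]
      simp only [← Multiset.singleton_add]
      abel
  · refine Admissible.cons_path (Admissible.cons_path (R.of_cons_path.of_cons_path.mono
      fun e he heh => hh' e (by simp [hE, he]) heh) ?_ (e := s(c, z₁))
      (by simp [pathEdges_append_cons_cons]) hcz) ?_ (e := s(a, x₁))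
      (by simp [pathEdges_append_cons_cons]) hax
    · rw [← Multiset.coe_nodup]
      have : ((A' ++ c :: z₁ :: x₁ :: x₂ :: y₂ :: y₁ :: z₂ :: g :: B' : List U) : Multiset U) =
          ([x₁, x₂, z₁, z₂, y₁, y₂] ++ (A' ++ c :: g :: B') : List U) := by
        simp only [← Multiset.coe_add, ← Multiset.cons_coe, Multiset.coe_nil]
        simp only [← Multiset.singleton_add]
        abel
      rw [this, Multiset.coe_nodup]
      exact hN.append hp₂ fun v hv hv' => hX' v hv (hp₂X v hv')
    · rw [← Multiset.coe_nodup]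
      have : ((A ++ a :: x₁ :: z₁ :: z₂ :: y₁ :: (D ++ d :: y₂ :: x₂ :: b :: B) : List U) :
          Multiset U) =
          ([x₁, x₂, z₁, z₂, y₁, y₂] ++ ((D ++ [d]) ++ (A ++ a :: b :: B)) : List U) := by
        simp only [← Multiset.coe_add, ← Multiset.cons_coe, Multiset.coe_nil]
        simp only [← Multiset.singleton_add]
        abel
      rw [this, Multiset.coe_nodup]
      refine hN.append (hnd.append hp₁ hdisj) fun v hv hv' => hX' v hv ?_
      rcases List.mem_append.1 hv' with hv' | hv'
      · exact hDX v hv'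
      · exact hp₁X v hv'

end Config

/-! ### Absorbing arbitrary cycles into exactly `k` paths -/

section Absorb

variable {V U : Type u} [DecidableEq U] {G : SimpleGraph V} {k : ℕ} {X : Set U}
  {h : Set (Sym2 U)} {Q C : Multiset (List U)}

/-- Account for moving `v` from a cycle `… d v w …` to a path using `ab`. The path becomes `a x q v
q' y b` and the cycle `d q x y q' w`, so they exchange `q v q'` for `xy`, and the jumps `qx`, `q'y`
are made by both. -/
theorem Ledger.detour [Infinite U] (hk : 2 ≤ k) {E : Multiset (Sym2 U)} {T : Multiset U}
    {d v w a b : U} (L : Ledger G k X h (s(d, v) ::ₘ s(v, w) ::ₘ s(a, b) ::ₘ E) T)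
    (hdv : s(d, v) ∈ h) (hvw : s(v, w) ∈ h) (hab : s(a, b) ∈ h) :
    ∃ q q' x y X' h', Ledger G k X' h'
      (s(d, q) ::ₘ s(q, v) ::ₘ s(v, q') ::ₘ s(q', w) ::ₘ s(a, x) ::ₘ s(x, y) ::ₘ s(y, b) ::ₘ
        s(q, x) ::ₘ s(q, x) ::ₘ s(q', y) ::ₘ s(q', y) ::ₘ E)
      (q ::ₘ q ::ₘ q' ::ₘ q' ::ₘ x ::ₘ x ::ₘ y ::ₘ y ::ₘ T) ∧
      [q, q', x, y].Nodup ∧ (∀ v ∈ [q, q', x, y], v ∉ X) ∧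
      s(a, x) ∈ h' ∧ s(q', w) ∈ h' ∧ ∀ e ∈ E, e ∈ h → e ∈ h' := by
  have hdX : d ∈ X := L.mem_of_mem_edges s(d, v) (by simp) d (by simp)
  have hvX : v ∈ X := L.mem_of_mem_edges s(d, v) (by simp) v (by simp)
  have hwX : w ∈ X := L.mem_of_mem_edges s(v, w) (by simp) w (by simp)
  have haX : a ∈ X := L.mem_of_mem_edges s(a, b) (by simp) a (by simp)
  have hbX : b ∈ X := L.mem_of_mem_edges s(a, b) (by simp) b (by simp)
  obtain ⟨q, h₁, L₁, F₁⟩ := L.subdivide hk hdv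
  obtain ⟨q', h₂, L₂, F₂⟩ := (L₁.congr (E' := s(v, w) ::ₘ s(d, q) ::ₘ s(q, v) ::ₘ s(a, b) ::ₘ E)
    (by simp only [← Multiset.singleton_add]; abel)).subdivide hk (F₁.mem_of_mem _ (by simp) hvw)
  obtain ⟨x, h₃, L₃, F₃⟩ := (L₂.congr (E' := s(a, b) ::ₘ s(v, q') ::ₘ s(q', w) ::ₘ s(d, q) ::ₘ
    s(q, v) ::ₘ E) (by simp only [← Multiset.singleton_add]; abel)).subdivide hk
    (F₂.mem_of_mem _ (by simp) (F₁.mem_of_mem _ (by simp) hab))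
  have n₁ := F₁.notMem
  have n₂ := F₂.notMem
  have n₃ := F₃.notMem
  have L₃' := L₃.jump (u := q) (w := x) (by simp) (by simp)
    (F₃.notMem_of_ne q (by rintro rfl; exact n₁ haX) (by rintro rfl; exact n₁ hbX))
  obtain ⟨y, h₄, L₄, F₄⟩ := (L₃'.congr (E' := s(x, b) ::ₘ s(a, x) ::ₘ s(v, q') ::ₘ s(q', w) ::ₘ
    s(d, q) ::ₘ s(q, v) ::ₘ s(q, x) ::ₘ s(q, x) ::ₘ E)
    (by simp only [← Multiset.singleton_add]; abel)).subdivide hk F₃.right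
  have n₄ := F₄.notMem
  have L₄' := L₄.jump (u := q') (w := y) (by simp) (by simp)
    (F₄.notMem_of_ne q' (by rintro rfl; exact n₃ (by simp))
      (by rintro rfl; exact n₂ (by simp [hbX])))
  refine ⟨q, q', x, y, insert y (insert x (insert q' (insert q X))), h₄, ?_, ?_, ?_, ?_, ?_, ?_⟩
  · convert L₄' using 1
    · simp only [← Multiset.singleton_add]
      abel
    · simp only [← Multiset.singleton_add]
      abel
  · simp only [Set.mem_insert_iff, not_or] at n₁ n₂ n₃ n₄
    simp only [List.nodup_cons, List.mem_cons, List.not_mem_nil, or_false, not_or, not_false_eq_true,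
      List.nodup_nil, and_true]
    grind
  · simp only [Set.mem_insert_iff, not_or] at n₁ n₂ n₃ n₄
    simp only [List.mem_cons, List.not_mem_nil, or_false]
    grind
  · exact F₄.mem_of_mem _ (by simp) F₃.left
  · exact F₄.mem_of_mem _ (by simp) (F₃.mem_of_mem _ (by simp) F₂.right)
  · intro e he heh
    exact F₄.mem_of_mem _ (by simp [he]) (F₃.mem_of_mem _ (by simp [he]) (F₂.mem_of_mem _
      (by simp [he]) (F₁.mem_of_mem _ (by simp [he]) heh)))

theorem card_le_count_totalVerts {v : U} (H : ∀ p ∈ Q, v ∈ p) :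
    Q.card ≤ (totalVerts Q C).count v := by
  induction Q using Multiset.induction with
  | empty => simp
  | cons p Q ih =>
    have h1 := ih fun q hq => H q (Multiset.mem_cons_of_mem hq)
    have h2 : 0 < (p : Multiset U).count v := Multiset.count_pos.2 (by simpa using H p (by simp))
    rw [totalVerts_cons_path, Multiset.count_add, Multiset.card_cons]
    omega

/-- Induction along the cycle: the part up to `d` already avoids `p₁`, and `rest` is still to be
checked. Only the edges from `d` onwards need to lie in `h`, as the earlier part may contain jumps.
When `rest` is exhausted, the cycle is disjoint from `p₁`. -/
theorem exists_absorb_walk [Infinite U] (hk : 2 ≤ k) {f : U} (rest : List U) :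
    ∀ {X : Set U} {h : Set (Sym2 U)} {p₁ : List U} {Q : Multiset (List U)} {D F : List U} {d : U},
    (p₁ ::ₘ Q).card = k → D ++ [d] = f :: F →
    Ledger G k X h (pathEdges (D ++ d :: (rest ++ [f])) + totalEdges (p₁ ::ₘ Q) C)
      ((D ++ d :: rest : List U) + totalVerts (p₁ ::ₘ Q) C) →
    Admissible h (p₁ ::ₘ Q) C → (∀ e ∈ pathEdges (d :: (rest ++ [f])), e ∈ h) →
    (D ++ d :: rest).Nodup → (∀ v ∈ D ++ [d], v ∉ p₁) →
    ∃ (X' : Set U) (h' : Set (Sym2 U)) (Q' : Multiset (List U)), Q'.card = k ∧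
      Ledger G k X' h' (totalEdges Q' C) (totalVerts Q' C) ∧ Admissible h' Q' C := by
  induction rest with
  | nil =>
    intro X h p₁ Q D F d hQ hD L R hr hnd hdisj
    obtain ⟨p₂, Q, rfl⟩ : ∃ p₂ Q', Q = p₂ ::ₘ Q' := by
      have : Q ≠ 0 := by rintro rfl; simp at hQ; omega
      obtain ⟨p₂, hp₂⟩ := Multiset.exists_mem_of_ne_zero this
      exact ⟨p₂, Multiset.exists_cons_of_mem hp₂⟩
    obtain ⟨X', h', p₁', p₂', L', R'⟩ := exists_absorb_of_disjoint hk hD L R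
      (hr _ (by simp)) hnd hdisj
    exact ⟨X', h', _, by simpa using hQ, L', R'⟩
  | cons v rest ih =>
    intro X h p₁ Q D F d hQ hD L R hr hnd hdisj
    by_cases hv : v ∈ p₁
    -- The vertex after `v` on the cycle, which is `f` if `v` is the last one.
    · obtain ⟨w, Y, hwY⟩ : ∃ w Y, rest ++ [f] = w :: Y := by
        cases rest with
        | nil => exact ⟨f, [], rfl⟩
        | cons w Y => exact ⟨w, Y ++ [f], rfl⟩
      -- The cycle uses one of the at most `k` visits to `v`, so the `k` paths cannot all contain
      -- `v`.
      obtain ⟨p, hpQ, hvp⟩ : ∃ p ∈ p₁ ::ₘ Q, v ∉ p := by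
        by_contra! H
        have h1 := card_le_count_totalVerts (C := C) H
        have h2 := L.count_le v
        have h3 : 0 < ((D ++ d :: v :: rest : List U) : Multiset U).count v :=
          Multiset.count_pos.2 (by simp)
        rw [Multiset.count_add] at h2
        omega
      obtain ⟨Q, rfl⟩ := Multiset.exists_cons_of_mem
        ((Multiset.mem_cons.1 hpQ).resolve_left fun h' => hvp (h' ▸ hv))
      obtain ⟨e, he, hab⟩ := R.path_edge p (by simp)
      obtain ⟨A, a, b, B, rfl, rfl⟩ := exists_eq_append_of_mem_pathEdges he
      have hp₁X : ∀ v ∈ p₁, v ∈ X := fun v hv =>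
        L.mem_of_mem_verts v (Multiset.mem_add.2 (Or.inr (mem_totalVerts_of_mem (by simp) hv)))
      have hpX : ∀ v ∈ A ++ a :: b :: B, v ∈ X := fun v hv =>
        L.mem_of_mem_verts v (Multiset.mem_add.2 (Or.inr (mem_totalVerts_of_mem (by simp) hv)))
      have hDX : ∀ u ∈ D ++ d :: v :: rest, u ∈ X := fun v hv =>
        L.mem_of_mem_verts v (Multiset.mem_add.2 (Or.inl hv))
      have hp := R.path_nodup (A ++ a :: b :: B) (by simp)
      have hvX := hDX v (by simp)
      rw [List.cons_append, hwY] at hr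
      obtain ⟨E, hE⟩ : ∃ E, E = pathEdges (D ++ [d]) + pathEdges (w :: Y) +
        (pathEdges (A ++ [a]) + pathEdges (b :: B)) + totalEdges (p₁ ::ₘ Q) C := ⟨_, rfl⟩
      obtain ⟨q, q', x, y, X', h', L', hN, hX', hax, hqw, hh'⟩ := (L.congr
        (E' := s(d, v) ::ₘ s(v, w) ::ₘ s(a, b) ::ₘ E) (by
          rw [List.cons_append, hwY]
          simp only [totalEdges_cons_path, pathEdges_append_cons_cons, hE, pathEdges_cons_cons]
          simp only [← Multiset.singleton_add]
          abel)).detour hk (hr _ (by simp)) (hr _ (by simp)) hab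
      -- The path `p` takes over `v`. The cycle passes through `q, x, y, q'` instead, which are new
      -- and hence off `p₁`, and continues from `q'`.
      refine ih (X := X') (h := h') (p₁ := p₁)
        (Q := (A ++ a :: x :: q :: v :: q' :: y :: b :: B) ::ₘ Q)
        (D := D ++ [d, q, x, y]) (d := q') (F := F ++ [q, x, y, q']) ?_ ?_ ?_ ?_ ?_ ?_ ?_
      · simpa using hQ
      · calc D ++ [d, q, x, y] ++ [q'] = (D ++ [d]) ++ [q, x, y, q'] := by simp
          _ = _ := by rw [hD]; simp
      · rw [hwY]
        convert L' using 1
        · simp only [totalEdges_cons_path, List.append_assoc, List.cons_append, List.nil_append,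
            pathEdges_append_cons_cons, pathEdges_cons_cons, hE]
          rw [Sym2.eq_swap (a := x) (b := q), Sym2.eq_swap (a := y) (b := q')]
          simp only [← Multiset.singleton_add]
          abel
        · simp only [totalVerts_cons_path, ← Multiset.coe_add, ← Multiset.cons_coe,
            Multiset.coe_nil]
          simp only [← Multiset.singleton_add]
          abel
      · rw [Multiset.cons_swap]
        rw [Multiset.cons_swap] at R
        refine Admissible.cons_path (R.of_cons_path.mono fun e he heh =>
          hh' e (by rw [hE]; exact Multiset.mem_add.2 (Or.inr he)) heh) ?_ (e := s(a, x))
          (by simp [pathEdges_append_cons_cons]) hax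
        rw [← Multiset.coe_nodup]
        have : ((A ++ a :: x :: q :: v :: q' :: y :: b :: B : List U) : Multiset U) =
            ([q, q', x, y] ++ v :: (A ++ a :: b :: B) : List U) := by
          simp only [← Multiset.coe_add, ← Multiset.cons_coe, Multiset.coe_nil]
          simp only [← Multiset.singleton_add]
          abel
        rw [this, Multiset.coe_nodup]
        refine hN.append (List.nodup_cons.2 ⟨hvp, hp⟩) fun u hu hu' => hX' u hu ?_
        rcases List.mem_cons.1 hu' with rfl | hu'
        · exact hvX
        · exact hpX u hu'
      · rw [hwY]
        intro e he
        rcases Multiset.mem_cons.1 he with rfl | he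
        · exact hqw
        · exact hh' e (by simp [hE, he]) (hr e (by simp [he]))
      · rw [← Multiset.coe_nodup]
        have : ((D ++ [d, q, x, y] ++ q' :: rest : List U) : Multiset U) =
            ([q, q', x, y] ++ (D ++ d :: rest) : List U) := by
          simp only [← Multiset.coe_add, ← Multiset.cons_coe, Multiset.coe_nil]
          simp only [← Multiset.singleton_add]
          abel
        rw [this, Multiset.coe_nodup]
        refine hN.append (hnd.sublist (by simp)) fun u hu hu' => hX' u hu (hDX u ?_)
        grind
      · intro u hu hu'
        have hu2 := hp₁X u hu'
        have := hdisj u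
        have := hX' u
        grind
    · refine ih (X := X) (D := D ++ [d]) (d := v) (F := F ++ [v]) hQ (by rw [hD]; simp) ?_ R ?_ (by simpa using hnd) ?_
      · simpa using L
      · intro e he
        exact hr e (by simp only [List.cons_append, pathEdges_cons_cons] at he ⊢; simp [he])
      · intro u hu
        rcases List.mem_append.1 hu with hu | hu
        · exact hdisj u hu
        · rw [List.mem_singleton.1 hu]; exact hv

/-- Subdividing the closing edge supplies a starting vertex `f` that is certainly off `p₁`. -/
theorem exists_absorb_cycle [Infinite U] (hk : 2 ≤ k) {c : List U} (hQ : Q.card = k)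
    (L : Ledger G k X h (totalEdges Q (c ::ₘ C)) (totalVerts Q (c ::ₘ C)))
    (R : Admissible h Q (c ::ₘ C)) :
    ∃ (X' : Set U) (h' : Set (Sym2 U)) (Q' : Multiset (List U)), Q'.card = k ∧
      Ledger G k X' h' (totalEdges Q' C) (totalVerts Q' C) ∧ Admissible h' Q' C := by
  obtain ⟨p₁, Q, rfl⟩ : ∃ p₂ Q', Q = p₂ ::ₘ Q' := by
    have : Q ≠ 0 := by rintro rfl; simp at hQ; omega
    obtain ⟨p₂, hp₂⟩ := Multiset.exists_mem_of_ne_zero this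
    exact ⟨p₂, Multiset.exists_cons_of_mem hp₂⟩
  have hcX : ∀ u ∈ c, u ∈ X := fun u hu => L.mem_of_mem_verts u (by simp [hu])
  have hp₁X : ∀ u ∈ p₁, u ∈ X := fun u hu =>
    L.mem_of_mem_verts u (mem_totalVerts_of_mem (by simp) hu)
  have hc := R.cycle_nodup c (by simp)
  have hce := R.cycle_edge c (by simp)
  obtain ⟨A, u, hA⟩ : ∃ A u, c = A ++ [u] :=
    ⟨_, _, (List.dropLast_append_getLast (R.cycle_ne_nil c (by simp))).symm⟩
  obtain ⟨v, l, hl⟩ : ∃ v l, c = v :: l := List.exists_cons_of_ne_nil (R.cycle_ne_nil c (by simp))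
  have hcyc : cycleEdges c = s(u, v) ::ₘ pathEdges c := by
    conv_lhs => rw [hl]
    rw [cycleEdges, ← hl, hA, List.append_assoc, List.cons_append, List.nil_append,
      pathEdges_append_cons_cons]
    simp
  rw [hcyc] at hce
  obtain ⟨f, h', L', F'⟩ := (L.congr (E' := s(u, v) ::ₘ (pathEdges c + totalEdges (p₁ ::ₘ Q) C)) (by
    rw [totalEdges_cons_cycle, hcyc, Multiset.cons_add])).subdivide hk (hce _ (by simp))
  have hfX := F'.notMem
  have hpe : pathEdges (f :: (c ++ [f])) = s(f, v) ::ₘ s(u, f) ::ₘ pathEdges c := by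
    have : pathEdges (c ++ [f]) = s(u, f) ::ₘ pathEdges c := by
      rw [hA, List.append_assoc, List.cons_append, List.nil_append, pathEdges_append_cons_cons]
      simp
    conv_lhs => rw [hl]
    rw [List.cons_append, pathEdges_cons_cons, ← List.cons_append, ← hl, this]
  refine exists_absorb_walk (X := insert f X) (h := h') (D := []) (F := []) (d := f) (f := f)
    hk c hQ rfl ?_ ?_ ?_ ?_ ?_
  -- Only the cycle passes through `f`, so the second visit charged for it is given back.
  · refine Ledger.mono (T := f ::ₘ f ::ₘ totalVerts (p₁ ::ₘ Q) (c ::ₘ C)) ?_ ?_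
    · refine L'.congr ?_
      rw [List.nil_append, hpe]
      simp only [← Multiset.singleton_add]
      abel
    · rw [totalVerts_cons_cycle]
      simp only [List.nil_append, ← Multiset.cons_coe, Multiset.cons_add]
      exact Multiset.le_cons_self _ _
  · exact R.of_cons_cycle.mono fun e he heh =>
      F'.mem_of_mem e (Multiset.mem_add.2 (Or.inr he)) heh
  · rw [hpe]
    intro e he
    rcases Multiset.mem_cons.1 he with rfl | he
    · exact F'.right
    rcases Multiset.mem_cons.1 he with rfl | he
    · exact F'.left
    · exact F'.mem_of_mem e (by simp [he]) (hce e (by simp [he]))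
  · exact List.nodup_cons.2 ⟨fun h' => hfX (hcX f h'), hc⟩
  · intro w hw hw'
    rw [List.nil_append, List.mem_singleton] at hw
    exact hfX (hw ▸ hp₁X w hw')

theorem exists_absorb_cycles [Infinite U] (hk : 2 ≤ k) (C : Multiset (List U)) :
    ∀ {X : Set U} {h : Set (Sym2 U)} {Q : Multiset (List U)}, Q.card = k →
    Ledger G k X h (totalEdges Q C) (totalVerts Q C) → Admissible h Q C →
    ∃ (X' : Set U) (h' : Set (Sym2 U)) (Q' : Multiset (List U)), Q'.card = k ∧
      Ledger G k X' h' (totalEdges Q' 0) (totalVerts Q' 0) ∧ Admissible h' Q' 0 := by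
  induction C using Multiset.induction with
  | empty => exact fun hQ L R => ⟨_, _, _, hQ, L, R⟩
  | cons c C ih =>
    intro X h Q hQ L R
    obtain ⟨X', h', Q', hQ', L', R'⟩ := exists_absorb_cycle hk hQ L R
    exact ih hQ' L' R'

theorem exists_card_eq [Infinite U] (hk : 2 ≤ k) (n : ℕ) :
    ∀ {X : Set U} {h : Set (Sym2 U)} {Q : Multiset (List U)}, Q ≠ 0 → Q.card + n = k →
    Ledger G k X h (totalEdges Q C) (totalVerts Q C) → Admissible h Q C →
    ∃ (X' : Set U) (h' : Set (Sym2 U)) (Q' : Multiset (List U)), Q'.card = k ∧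
      Ledger G k X' h' (totalEdges Q' C) (totalVerts Q' C) ∧ Admissible h' Q' C := by
  induction n with
  | zero => exact fun _ hQ L R => ⟨_, _, _, hQ, L, R⟩
  | succ n ih =>
    intro X h Q hQ0 hQ L R
    obtain ⟨p, hp⟩ := Multiset.exists_mem_of_ne_zero hQ0
    obtain ⟨Q, rfl⟩ := Multiset.exists_cons_of_mem hp
    obtain ⟨X', h', p', p'', L', R'⟩ := exists_split hk L R
    exact ih (by simp) (by simp at hQ ⊢; omega) L' R'

/-- Subdivide one edge twice, at `z₁` and `z₂`. The segment `z₁z₂` and the rest of the cycle are two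
paths with common ends. -/
theorem exists_paths_of_cycle [Infinite U] (hk : 2 ≤ k) {c : List U}
    (L : Ledger G k X h (totalEdges 0 (c ::ₘ C)) (totalVerts 0 (c ::ₘ C)))
    (R : Admissible h 0 (c ::ₘ C)) :
    ∃ (X' : Set U) (h' : Set (Sym2 U)) (Q' : Multiset (List U)), Q'.card = 2 ∧
      Ledger G k X' h' (totalEdges Q' C) (totalVerts Q' C) ∧ Admissible h' Q' C := by
  obtain ⟨v, l, rfl⟩ := List.exists_cons_of_ne_nil (R.cycle_ne_nil c (by simp))
  have hc := R.cycle_nodup _ (Multiset.mem_cons_self _ _)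
  have hce := R.cycle_edge _ (Multiset.mem_cons_self _ _)
  have hcX : ∀ u ∈ v :: l, u ∈ X := fun u hu =>
    L.mem_of_mem_verts u (by rw [totalVerts_cons_cycle]; exact Multiset.mem_add.2 (Or.inl hu))
  cases l with
  | nil => simpa using L.not_isDiag _ (hce s(v, v) (by simp [cycleEdges]))
  | cons w l =>
    simp only [cycleEdges, List.cons_append, pathEdges_cons_cons] at hce
    obtain ⟨z₁, h₁, L₁, F₁⟩ := (L.congr (E' := s(v, w) ::ₘ (pathEdges (w :: (l ++ [v])) +
      totalEdges 0 C)) (by simp [cycleEdges])).subdivide hk (hce _ (by simp))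
    obtain ⟨z₂, h₂, L₂, F₂⟩ := (L₁.congr (Multiset.cons_swap _ _ _)).subdivide hk F₁.right
    have n₁ := F₁.notMem
    have n₂ := F₂.notMem
    have hl : pathEdges (z₂ :: w :: (l ++ [v, z₁])) =
        s(z₂, w) ::ₘ s(v, z₁) ::ₘ pathEdges (w :: (l ++ [v])) := by
      rw [pathEdges_cons_cons, ← List.cons_append, pathEdges_append_cons_cons]
      simp
    refine ⟨insert z₂ (insert z₁ X), h₂, [z₁, z₂] ::ₘ (z₂ :: w :: (l ++ [v, z₁])) ::ₘ 0, by simp, ?_, ?_⟩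
    · convert L₂ using 1
      · simp only [totalEdges_cons_path, hl, pathEdges_cons_cons, pathEdges_singleton]
        simp only [← Multiset.singleton_add]
        abel
      · simp only [totalVerts_cons_path, totalVerts_cons_cycle, ← Multiset.coe_add,
          ← Multiset.cons_coe, Multiset.coe_nil]
        simp only [← Multiset.singleton_add]
        abel
    · refine Admissible.cons_path (Admissible.cons_path (R.of_cons_cycle.mono fun e he heh =>
        F₂.mem_of_mem e (by simp [he]) (F₁.mem_of_mem e (by simp [he]) heh)) ?_ (e := s(z₂, w))
        (by simp) F₂.right) ?_ (e := s(z₁, z₂)) (by simp) F₂.left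
      · rw [← Multiset.coe_nodup]
        have : ((z₂ :: w :: (l ++ [v, z₁]) : List U) : Multiset U) =
            (z₂ :: z₁ :: v :: w :: l : List U) := by
          simp only [← Multiset.coe_add, ← Multiset.cons_coe, Multiset.coe_nil]
          simp only [← Multiset.singleton_add]
          abel
        rw [this, Multiset.coe_nodup, List.nodup_cons, List.nodup_cons, List.mem_cons]
        exact ⟨fun h' => n₂ (h'.imp id (hcX z₂)), fun h' => n₁ (hcX z₁ h'), hc⟩
      · simp only [Set.mem_insert_iff, not_or] at n₁ n₂
        grind

/-- A cover of a graph with at least one edge by at most `k` paths and some cycles becomes, after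
subdivision, a cover by exactly `k` paths. -/
theorem exists_paths [Infinite U] (hk : 2 ≤ k) (hQk : Q.card ≤ k) (hQC : Q ≠ 0 ∨ C ≠ 0)
    (L : Ledger G k X h (totalEdges Q C) (totalVerts Q C)) (R : Admissible h Q C) :
    ∃ (X' : Set U) (h' : Set (Sym2 U)) (Q' : Multiset (List U)), Q'.card = k ∧
      Ledger G k X' h' (totalEdges Q' 0) (totalVerts Q' 0) ∧ Admissible h' Q' 0 := by
  by_cases hQ : Q = 0
  · subst hQ
    obtain ⟨c, hc⟩ := Multiset.exists_mem_of_ne_zero (hQC.resolve_left (by simp))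
    obtain ⟨C, rfl⟩ := Multiset.exists_cons_of_mem hc
    obtain ⟨X₁, h₁, Q₁, hQ₁, L₁, R₁⟩ := exists_paths_of_cycle hk L R
    obtain ⟨X₂, h₂, Q₂, hQ₂, L₂, R₂⟩ := exists_card_eq hk (k - 2)
      (by rintro rfl; simp at hQ₁) (by omega) L₁ R₁
    exact exists_absorb_cycles hk C hQ₂ L₂ R₂
  · obtain ⟨X₂, h₂, Q₂, hQ₂, L₂, R₂⟩ := exists_card_eq hk (k - Q.card) hQ (by omega) L R
    exact exists_absorb_cycles hk C hQ₂ L₂ R₂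

end Absorb

/-! ### From lists back to path odd-covers -/

section Realization

variable {V U : Type u}

theorem pathEdges_support {G : SimpleGraph V} {u v : V} (p : G.Walk u v) :
    pathEdges p.support = p.edges := by
  induction p with
  | nil => simp
  | cons hadj p ih =>
    rw [SimpleGraph.Walk.edges_cons, ← Multiset.cons_coe, ← ih]
    cases p <;> simp

theorem pathEdges_map {W : Type u} (f : U → W) : ∀ l : List U,
    pathEdges (l.map f) = (pathEdges l).map (Sym2.map f)
  | [] => rfl
  | [_] => rfl
  | a :: b :: l => by
    have := pathEdges_map f (b :: l)
    simp only [List.map_cons] at this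
    simp [this]

theorem cycleEdges_map {W : Type u} (f : U → W) (l : List U) :
    cycleEdges (l.map f) = (cycleEdges l).map (Sym2.map f) := by
  cases l with
  | nil => rfl
  | cons a l => simp [cycleEdges, ← pathEdges_map]

theorem exists_completePath_of_nodup {l : List V} (hl : l ≠ []) (hnd : l.Nodup) :
    ∃ P : CompletePath V, pathEdges l = P.walk.edges := by
  have hchain : l.IsChain (⊤ : SimpleGraph V).Adj :=
    List.Pairwise.isChain (hnd.imp fun h => by simpa using h)
  refine ⟨⟨_, _, SimpleGraph.Walk.ofSupport l hl hchain, ?_⟩, ?_⟩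
  · rw [SimpleGraph.Walk.isPath_def, SimpleGraph.Walk.support_ofSupport]
    exact hnd
  · rw [← pathEdges_support, SimpleGraph.Walk.support_ofSupport]

theorem ncard_mem_edges [DecidableEq V] {k : ℕ} (P : Fin k → CompletePath V) (e : Sym2 V) :
    Set.ncard {i : Fin k | e ∈ (P i).walk.edges} =
      ∑ i, ((P i).walk.edges : Multiset (Sym2 V)).count e := by
  classical
  rw [Set.ncard_eq_toFinset_card', Finset.card_eq_sum_ones, Finset.sum_congr rfl
    (fun i _ => Multiset.count_eq_of_nodup (a := e)
      (Multiset.coe_nodup.2 (SimpleGraph.Walk.edges_nodup_of_support_nodup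
        ((P i).walk.isPath_def.1 (P i).isPath)))), Finset.sum_ite]
  simp

variable [DecidableEq U] {G : SimpleGraph V} {k : ℕ} {X : Set U}
  {h : Set (Sym2 U)} {Q : Multiset (List U)}

/-- Edges of `h` have total count one and all other pairs have even count, so parity recovers `h`.
-/
theorem exists_isPathOddCover_of_ledger {m : ℕ} (hQ : Q.card = k)
    (L : Ledger G m X h (totalEdges Q 0) (totalVerts Q 0)) (R : Admissible h Q 0) :
    ∃ (W : Type u) (H : SimpleGraph W), IsSubdivision G H ∧
      ∃ P : Fin k → CompletePath W, IsPathOddCover H P := by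
  refine ⟨X, graphOn X h, L.isSubdivision, ?_⟩
  obtain ⟨f, rfl⟩ : ∃ f : Fin k → List U, Q = Finset.univ.val.map f := by
    subst hQ
    induction Q using Quotient.inductionOn with
    | h l =>
      refine ⟨l.get, ?_⟩
      change (l : Multiset (List U)) = ((List.finRange l.length).map l.get : List (List U))
      simp
  have hf : ∀ i, f i ∈ Finset.univ.val.map f := fun i => Multiset.mem_map_of_mem f (by simp)
  have : ∀ i, ∃ P : CompletePath X,
      (pathEdges (f i)) = (P.walk.edges : Multiset (Sym2 X)).map (Sym2.map (↑)) := by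
    intro i
    have hX : ∀ v ∈ f i, v ∈ X := fun v hv =>
      L.mem_of_mem_verts v (mem_totalVerts_of_mem (hf i) hv)
    have hnd := R.path_nodup _ (hf i)
    obtain ⟨e, he, -⟩ := R.path_edge _ (hf i)
    generalize f i = p at *
    lift p to List X using hX
    obtain ⟨P, hP⟩ := exists_completePath_of_nodup (l := p) (by rintro rfl; simp at he)
      (List.Nodup.of_map _ hnd)
    exact ⟨P, by rw [pathEdges_map, hP]⟩
  choose P hP using this
  refine ⟨P, fun e => ?_⟩
  rw [ncard_mem_edges]
  have hcount : ∑ i, ((P i).walk.edges : Multiset (Sym2 X)).count e =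
      (totalEdges (Finset.univ.val.map f) 0).count (e.map (↑)) := by
    simp only [totalEdges, Multiset.map_map, Multiset.map_zero, Multiset.sum_zero, add_zero,
      Multiset.count_sum, Function.comp_def, hP]
    rw [Finset.sum]
    congr 1
    refine Multiset.map_congr rfl fun i _ => ?_
    rw [Multiset.count_map_eq_count' _ _ (Sym2.map.injective Subtype.val_injective)]
  rw [hcount]
  have key : e ∈ (graphOn X h).edgeSet ↔ e.map (↑) ∈ h := by
    induction e using Sym2.ind with
    | h a b =>
      simp only [SimpleGraph.mem_edgeSet, graphOn, Sym2.map_mk, ne_eq, and_iff_right_iff_imp]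
      intro he hab
      exact L.not_isDiag _ he (by simp [hab])
  rw [key]
  constructor
  · intro he
    rw [L.count_eq_one _ he]
    exact odd_one
  · intro ho
    by_contra he
    exact Nat.not_even_iff_odd.2 ho (L.even_count _ he)

end Realization

/-! ### Incidence counts and cycle decompositions of even graphs -/

section Incidence

variable {V : Type u} [DecidableEq V]

/-- Every occurrence of `v` accounts for two incidences, except that one is missing at each end of
the list. -/
theorem countP_pathEdges (v : V) : ∀ (a : V) (l : List V), (a :: l).IsChain (· ≠ ·) →
    (pathEdges (a :: l)).countP (v ∈ ·) + (if v = a then 1 else 0) +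
      (if v = (a :: l).getLast (by simp) then 1 else 0) = 2 * (a :: l).count v
  | a, [], _ => by
    by_cases h : v = a
    · simp [h]
    · simp [h, Ne.symm h]
  | a, b :: l, hc => by
    have ih := countP_pathEdges v b l (List.isChain_cons_cons.1 hc).2
    have hab := (List.isChain_cons_cons.1 hc).1
    rw [pathEdges_cons_cons, Multiset.countP_cons, List.count_cons, List.getLast_cons (by simp)]
    simp only [Sym2.mem_iff, beq_iff_eq]
    grind

theorem countP_cycleEdges (v : V) {c : List V} (hc : c.Nodup) (hl : 2 ≤ c.length) :
    (cycleEdges c).countP (v ∈ ·) = 2 * (c : Multiset V).count v := by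
  rw [Multiset.coe_count]
  match c, hl with
  | a :: b :: l, _ =>
    have hchain : (a :: (b :: l ++ [a])).IsChain (· ≠ ·) := by
      refine List.isChain_cons_cons.2 ⟨by grind, ?_⟩
      refine ((List.perm_append_singleton a (b :: l)).nodup_iff.2 hc).isChain
    have := countP_pathEdges v a (b :: l ++ [a]) hchain
    have hlast : (a :: (b :: l ++ [a])).getLast (by simp) = a := by simp
    simp only [hlast] at this
    simp only [cycleEdges, List.cons_append] at this ⊢
    simp only [List.count_cons, List.count_append, List.count_nil, beq_iff_eq] at this ⊢
    grind

/-- In an acyclic graph, the first vertex of a longest path would have degree one. -/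
theorem exists_isCycle_of_even {S : Set (Sym2 V)} [Fintype V] [Fintype S]
    (hd : ∀ e ∈ S, ¬ e.IsDiag) (hS : S.Nonempty)
    (heven : ∀ v : V, Even (S.toFinset.val.countP (v ∈ ·))) :
    ∃ (v : V) (p : (SimpleGraph.fromEdgeSet S).Walk v v), p.IsCycle := by
  by_contra! hac
  have hac : (SimpleGraph.fromEdgeSet S).IsAcyclic := fun v p => hac v p
  have hex : ∃ n, ∃ (u v : V) (p : (SimpleGraph.fromEdgeSet S).Walk u v),
      p.IsPath ∧ p.length = n ∧ 1 ≤ n := by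
    obtain ⟨e, he⟩ := hS
    induction e using Sym2.ind with
    | h a b =>
      have : (SimpleGraph.fromEdgeSet S).Adj a b := by
        simpa [he] using hd _ he
      exact ⟨1, a, b, this.toWalk, SimpleGraph.Walk.IsPath.of_adj this, rfl, le_rfl⟩
  obtain ⟨n, ⟨u, v, p, hp, hpn, hn⟩, hmax⟩ : ∃ n, (∃ (u v : V)
      (p : (SimpleGraph.fromEdgeSet S).Walk u v), p.IsPath ∧ p.length = n ∧ 1 ≤ n) ∧
      ∀ (u v : V) (p : (SimpleGraph.fromEdgeSet S).Walk u v), p.IsPath → p.length ≤ n := by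
    classical
    obtain ⟨n₀, hn₀⟩ := hex
    let f : ℕ → Prop := fun n => ∃ (u v : V) (p : (SimpleGraph.fromEdgeSet S).Walk u v),
      p.IsPath ∧ p.length = n ∧ 1 ≤ n
    have hb : ∀ n, f n → n ≤ Fintype.card V := fun n ⟨u, v, p, hp, hpn, _⟩ => hpn ▸ hp.length_lt.le
    refine ⟨Nat.findGreatest f (Fintype.card V), Nat.findGreatest_spec (P := f) (hb n₀ hn₀) hn₀, ?_⟩
    intro u v p hp
    rcases Nat.eq_zero_or_pos p.length with h0 | h0
    · omega
    · exact Nat.le_findGreatest (hp.length_lt.le) ⟨u, v, p, hp, rfl, h0⟩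
  have hnil : ¬ p.Nil := by
    rw [← SimpleGraph.Walk.length_eq_zero_iff]; omega
  have hsnd := SimpleGraph.Walk.adj_snd hnil
  rw [SimpleGraph.fromEdgeSet_adj] at hsnd
  obtain ⟨e, heS, hue, hne⟩ : ∃ e ∈ S, u ∈ e ∧ e ≠ s(u, p.snd) := by
    by_contra! H
    have h1 := heven u
    have h2 : S.toFinset.val.countP (u ∈ ·) = 1 := by
      rw [Multiset.countP_eq_card_filter]
      have : S.toFinset.filter (u ∈ ·) = {s(u, p.snd)} := by
        ext e
        simp only [Finset.mem_filter, Set.mem_toFinset, Finset.mem_singleton]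
        constructor
        · exact fun he => H e he.1 he.2
        · rintro rfl; exact ⟨hsnd.1, by simp⟩
      exact congrArg Finset.card this
    rw [h2] at h1
    exact absurd h1 (by decide)
  obtain ⟨w, rfl⟩ := Sym2.mem_iff_exists.1 hue
  have hadj : (SimpleGraph.fromEdgeSet S).Adj u w := by
    simpa [heS] using hd _ heS
  -- In an acyclic graph the only neighbour of `u` on the path is the second vertex; so `w` prolongs
  -- the path.
  have hw : w ∉ p.support := fun hw => hne (by rw [hac.eq_snd_of_adj_start hp hadj hw])
  have := hmax w v (SimpleGraph.Walk.cons hadj.symm p) (hp.cons hw)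
  rw [SimpleGraph.Walk.length_cons] at this
  omega

omit [DecidableEq V] in
theorem exists_list_of_isCycle {G : SimpleGraph V} {v : V} {p : G.Walk v v} (hp : p.IsCycle) :
    ∃ c : List V, c.Nodup ∧ 3 ≤ c.length ∧ cycleEdges c = p.edges := by
  obtain ⟨l, hl⟩ : ∃ l, p.support = v :: (l ++ [v]) := by
    have h1 := p.cons_tail_support
    have hne : p.support.tail ≠ [] := by
      intro h'
      have := hp.three_le_length
      have h2 := p.length_support
      rw [← h1, h', List.length_singleton] at h2
      omega
    have h3 : p.support.tail.getLast hne = v := by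
      rw [List.getLast_tail]
      exact p.getLast_support
    refine ⟨p.support.tail.dropLast, ?_⟩
    conv_lhs => rw [← h1, ← List.dropLast_append_getLast hne, h3]
  refine ⟨v :: l, ?_, ?_, ?_⟩
  · have := hp.support_nodup
    rw [hl] at this
    simpa using List.nodup_middle.1 this
  · have := hp.three_le_length
    have h2 := p.length_support
    rw [hl] at h2
    simp at h2 ⊢
    omega
  · rw [cycleEdges, List.cons_append, ← hl, pathEdges_support]

theorem exists_cycle_decomposition [Fintype V] (S : Finset (Sym2 V)) (hd : ∀ e ∈ S, ¬ e.IsDiag)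
    (heven : ∀ v : V, Even (S.val.countP (v ∈ ·))) :
    ∃ C : Multiset (List V), (∀ c ∈ C, c.Nodup ∧ 3 ≤ c.length) ∧ (C.map cycleEdges).sum = S.val := by
  induction S using Finset.strongInduction with
  | H S ih =>
    rcases S.eq_empty_or_nonempty with rfl | hS
    · exact ⟨0, by simp⟩
    · obtain ⟨v, p, hp⟩ := exists_isCycle_of_even (S := (S : Set (Sym2 V))) (by simpa using hd)
        (by simpa using hS) (by simpa using heven)
      obtain ⟨c, hc, hcl, hce⟩ := exists_list_of_isCycle hp
      have hnd : (cycleEdges c).Nodup := by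
        rw [hce]; exact Multiset.coe_nodup.2 hp.isTrail.edges_nodup
      have hsub : ∀ e ∈ cycleEdges c, e ∈ S := by
        intro e he
        rw [hce] at he
        have := p.edges_subset_edgeSet he
        rw [SimpleGraph.edgeSet_fromEdgeSet] at this
        exact this.1
      have hle : cycleEdges c ≤ S.val := (Multiset.le_iff_subset hnd).2 hsub
      let S' : Finset (Sym2 V) := ⟨S.val - cycleEdges c, Multiset.nodup_of_le
        (Multiset.sub_le_self _ _) S.nodup⟩
      have hS' : S'.val + cycleEdges c = S.val := tsub_add_cancel_of_le hle
      have hss : S' ⊂ S := by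
        rw [Finset.ssubset_iff_subset_ne]
        refine ⟨fun e he => Multiset.mem_of_le (Multiset.sub_le_self _ _) he, fun h' => ?_⟩
        have h1 := congrArg Multiset.card hS'
        rw [h', Multiset.card_add] at h1
        have h2 := hp.three_le_length
        rw [hce, Multiset.coe_card, SimpleGraph.Walk.length_edges] at h1
        omega
      obtain ⟨C, hC, hCS⟩ := ih S' hss (fun e he => hd e (hss.1 he)) (fun v => by
        have h1 := heven v
        rw [← hS', Multiset.countP_add, countP_cycleEdges v hc (by omega)] at h1
        grind)
      refine ⟨c ::ₘ C, ?_, ?_⟩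
      · intro c' hc'
        rcases Multiset.mem_cons.1 hc' with rfl | hc'
        · exact ⟨hc, hcl⟩
        · exact hC c' hc'
      · rw [Multiset.map_cons, Multiset.sum_cons, hCS, add_comm, hS']

end Incidence

/-! ### Decomposition into paths and cycles by an apex -/

section Decomposition

variable {V : Type u}

theorem cycleEdges_append_comm : ∀ A B : List V, cycleEdges (A ++ B) = cycleEdges (B ++ A)
  | [], B => by simp
  | a :: A, [] => by simp
  | a :: A, b :: B => by
    have h1 : a :: A ++ b :: B ++ [a] = (a :: A) ++ b :: (B ++ [a]) := by simp
    have h2 : b :: B ++ a :: A ++ [b] = (b :: B) ++ a :: (A ++ [b]) := by simp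
    change pathEdges (a :: A ++ b :: B ++ [a]) = pathEdges (b :: B ++ a :: A ++ [b])
    rw [h1, h2, pathEdges_append_cons, pathEdges_append_cons (b :: B), add_comm]
    rfl

variable [DecidableEq V]

/-- Here `none` is the apex. A cycle through it can be rotated to start there, and deleting the apex
leaves a path. -/
theorem exists_map_some_of_nodup {c : List (Option V)} (hc : c.Nodup) (hl : 3 ≤ c.length) :
    (∃ c' : List V, c = c'.map some) ∨ ∃ p : List V, p.Nodup ∧ 2 ≤ p.length ∧
      (c : Multiset (Option V)) = none ::ₘ (p.map some : List (Option V)) ∧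
      (cycleEdges c).filter (none ∉ ·) = (pathEdges p).map (Sym2.map some) := by
  have lift_some : ∀ l : List (Option V), none ∉ l → ∃ l' : List V, l = l'.map some := by
    intro l hn
    induction l with
    | nil => exact ⟨[], rfl⟩
    | cons x l ih =>
      obtain ⟨l', rfl⟩ := ih fun h => hn (by simp [h])
      cases x with
      | none => simp at hn
      | some x => exact ⟨x :: l', rfl⟩
  by_cases hn : none ∈ c
  · right
    obtain ⟨A, B, rfl⟩ := List.append_of_mem hn
    have hperm : (A ++ none :: B : List (Option V)).Perm (none :: (B ++ A)) := by
      refine List.perm_middle.trans (List.Perm.cons _ List.perm_append_comm)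
    obtain ⟨hn', hnd⟩ := List.nodup_cons.1 (hperm.nodup_iff.1 hc)
    obtain ⟨p, hp⟩ := lift_some _ hn'
    have hlen : 2 ≤ p.length := by
      have h1 := hperm.length_eq
      rw [hp] at h1
      simp only [List.length_cons, List.length_map] at h1
      omega
    refine ⟨p, List.Nodup.of_map some (hp ▸ hnd), hlen, ?_, ?_⟩
    · rw [← hp]
      exact Multiset.coe_eq_coe.2 hperm
    · rw [cycleEdges_append_comm, List.cons_append, hp]
      have hne : p ≠ [] := by rintro rfl; simp at hlen
      obtain ⟨x, l, hx⟩ := List.exists_cons_of_ne_nil hne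
      obtain ⟨A, y, hy⟩ : ∃ A y, p = A ++ [y] :=
        ⟨_, _, (List.dropLast_append_getLast hne).symm⟩
      have h1 : pathEdges (p.map some ++ [none]) =
          s(some y, none) ::ₘ pathEdges (p.map some) := by
        rw [hy]
        simp only [List.map_append, List.map_cons, List.map_nil, List.append_assoc,
          List.cons_append, List.nil_append]
        rw [pathEdges_append_cons_cons]
        simp
      have h2 : cycleEdges (none :: p.map some) =
          s(none, some x) ::ₘ s(some y, none) ::ₘ pathEdges (p.map some) := by
        rw [← h1, cycleEdges, hx]
        simp
      rw [h2, Multiset.filter_cons_of_neg _ (by simp), Multiset.filter_cons_of_neg _ (by simp),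
        pathEdges_map, Multiset.filter_eq_self]
      intro e he hne
      obtain ⟨e, -, rfl⟩ := Multiset.mem_map.1 he
      simp at hne
  · exact Or.inl (lift_some c hn)

theorem exists_paths_of_apex_cycles (C : Multiset (List (Option V)))
    (hC : ∀ c ∈ C, c.Nodup ∧ 3 ≤ c.length) :
    ∃ Q C' : Multiset (List V), (∀ p ∈ Q, p.Nodup ∧ 2 ≤ p.length) ∧
      (∀ c ∈ C', c.Nodup ∧ 3 ≤ c.length) ∧
      (C.map cycleEdges).sum.filter (none ∉ ·) = (totalEdges Q C').map (Sym2.map some) ∧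
      (C.map cycleEdges).sum.countP (none ∈ ·) = 2 * Q.card ∧
      ∀ v : V, (C.map cycleEdges).sum.countP (some v ∈ ·) = 2 * (totalVerts Q C').count v := by
  induction C using Multiset.induction with
  | empty => exact ⟨0, 0, by simp [totalEdges, totalVerts]⟩
  | cons c C ih =>
    obtain ⟨Q, C', hQ, hC', hE, hn, hs⟩ := ih fun c' hc' => hC c' (Multiset.mem_cons_of_mem hc')
    obtain ⟨hc, hcl⟩ := hC c (Multiset.mem_cons_self _ _)
    rw [Multiset.map_cons, Multiset.sum_cons]
    rcases exists_map_some_of_nodup hc hcl with ⟨c', rfl⟩ | ⟨p, hp, hpl, hcp, hcE⟩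
    · refine ⟨Q, c' ::ₘ C', hQ, ?_, ?_, ?_, ?_⟩
      · intro c hc''
        rcases Multiset.mem_cons.1 hc'' with rfl | hc''
        · exact ⟨List.Nodup.of_map some hc, by simpa using hcl⟩
        · exact hC' c hc''
      · rw [Multiset.filter_add, hE, totalEdges_cons_cycle, Multiset.map_add, cycleEdges_map,
          Multiset.filter_eq_self.2]
        intro e he hne
        obtain ⟨e, -, rfl⟩ := Multiset.mem_map.1 he
        simp at hne
      · rw [Multiset.countP_add, hn, countP_cycleEdges _ hc (by omega), Multiset.count_eq_zero.2]
        · simp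
        · simp
      · intro v
        rw [Multiset.countP_add, hs, countP_cycleEdges _ hc (by omega), totalVerts_cons_cycle,
          Multiset.count_add, mul_add, ← Multiset.map_coe,
          Multiset.count_map_eq_count' _ _ (Option.some_injective V)]
    · refine ⟨p ::ₘ Q, C', ?_, hC', ?_, ?_, ?_⟩
      · intro q hq
        rcases Multiset.mem_cons.1 hq with rfl | hq
        · exact ⟨hp, hpl⟩
        · exact hQ q hq
      · rw [Multiset.filter_add, hE, totalEdges_cons_path, Multiset.map_add, hcE]
      · rw [Multiset.countP_add, hn, countP_cycleEdges _ hc (by omega), hcp,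
          Multiset.count_cons_self, Multiset.count_eq_zero.2 (by simp), Multiset.card_cons]
        ring
      · intro v
        rw [Multiset.countP_add, hs, countP_cycleEdges _ hc (by omega), totalVerts_cons_path,
          Multiset.count_add, mul_add, hcp, Multiset.count_cons_of_ne (by simp), ← Multiset.map_coe,
          Multiset.count_map_eq_count' _ _ (Option.some_injective V)]

/-- Every finite graph is an edge-disjoint union of paths and cycles in which half as many paths as
there are vertices of odd degree are used. -/
theorem exists_path_cycle_decomposition [Fintype V] (G : SimpleGraph V) [DecidableRel G.Adj] :
    ∃ Q C : Multiset (List V), (∀ p ∈ Q, p.Nodup ∧ 2 ≤ p.length) ∧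
      (∀ c ∈ C, c.Nodup ∧ 3 ≤ c.length) ∧ totalEdges Q C = G.edgeFinset.val ∧
      2 * Q.card = oddDegreeCount G ∧
      ∀ v, 2 * (totalVerts Q C).count v = G.degree v + if Odd (G.degree v) then 1 else 0 := by
  -- `S₁` is a copy of `G`, and `S₂` joins the apex to all odd vertices. All degrees become even,
  -- the apex included since the number of odd vertices is even.
  let S₁ : Finset (Sym2 (Option V)) :=
    G.edgeFinset.map ⟨Sym2.map some, Sym2.map.injective (Option.some_injective V)⟩
  let S₂ : Finset (Sym2 (Option V)) :=
    (Finset.univ.filter fun v : V => Odd (G.degree v)).map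
      ⟨fun v => s(none, some v), fun a b h => by simpa using h⟩
  have hdisj : Disjoint S₁ S₂ := by
    rw [Finset.disjoint_left]
    intro e h1 h2
    obtain ⟨e, -, rfl⟩ := Finset.mem_map.1 h1
    obtain ⟨v, -, hv⟩ := Finset.mem_map.1 h2
    have : none ∈ (Sym2.map some e) := by
      rw [show Sym2.map some e = s(none, some v) from hv.symm]
      simp
    simp at this
  let S := S₁.disjUnion S₂ hdisj
  have hS : S.val = G.edgeFinset.val.map (Sym2.map some) +
      (Finset.univ.filter fun v : V => Odd (G.degree v)).val.map fun v => s(none, some v) := rfl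
  have hcn : S.val.countP (none ∈ ·) = oddDegreeCount G := by
    rw [hS, Multiset.countP_add, Multiset.countP_map, Multiset.countP_map,
      Multiset.filter_eq_nil.2 (by simp), Multiset.filter_eq_self.2 (by simp)]
    simp [oddDegreeCount, Finset.card]
  have hcs : ∀ v, S.val.countP (some v ∈ ·) = G.degree v + if Odd (G.degree v) then 1 else 0 := by
    intro v
    rw [hS, Multiset.countP_add, Multiset.countP_map, Multiset.countP_map]
    congr 1
    · rw [← G.card_incidenceFinset_eq_degree, G.incidenceFinset_eq_filter]
      simp [Finset.card, Finset.filter]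
    · have : (Finset.univ.filter fun w : V => Odd (G.degree w)).filter (fun w => v = w) =
          if Odd (G.degree v) then {v} else ∅ := by
        ext w
        split_ifs <;> simp <;> grind
      have h2 := congrArg Finset.card this
      rw [apply_ite Finset.card] at h2
      simpa [Finset.card, Finset.filter] using h2
  obtain ⟨C, hC, hCS⟩ := exists_cycle_decomposition S (by
    intro e he
    rcases Finset.mem_disjUnion.1 he with he | he
    · obtain ⟨e, he', rfl⟩ := Finset.mem_map.1 he
      have := G.not_isDiag_of_mem_edgeFinset he'
      change ¬ (Sym2.map some e).IsDiag
      rwa [Sym2.isDiag_map (Option.some_injective V)]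
    · obtain ⟨v, -, rfl⟩ := Finset.mem_map.1 he
      change ¬ s(none, some v).IsDiag
      simp) (by
    rintro (_ | v)
    · rw [hcn]
      exact G.even_card_odd_degree_vertices
    · rw [hcs]
      split_ifs with h
      · exact h.add_one
      · simpa using h)
  obtain ⟨Q, C', hQ, hC', hE, hn, hs⟩ := exists_paths_of_apex_cycles C hC
  rw [hCS] at hE hn hs
  refine ⟨Q, C', hQ, hC', ?_, by rw [← hn, hcn], fun v => by rw [← hs, hcs]⟩
  apply Multiset.map_injective (Sym2.map.injective (Option.some_injective V))
  rw [← hE, hS, Multiset.filter_add, Multiset.filter_eq_self.2, Multiset.filter_eq_nil.2, add_zero]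
  · simp
  · intro e he hne
    obtain ⟨e, -, rfl⟩ := Multiset.mem_map.1 he
    simp at hne

end Decomposition

/-! ### The decomposition of `G` as a starting point -/

section Initial

variable {V U : Type u}

theorem totalEdges_map (f : V → U) (Q C : Multiset (List V)) :
    totalEdges (Q.map (List.map f)) (C.map (List.map f)) = (totalEdges Q C).map (Sym2.map f) := by
  induction Q using Multiset.induction with
  | empty =>
    induction C using Multiset.induction with
    | empty => simp [totalEdges]
    | cons c C ih =>
      simp only [Multiset.map_zero] at ih
      simp only [Multiset.map_cons, Multiset.map_zero, totalEdges_cons_cycle, Multiset.map_add, ih,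
        cycleEdges_map]
  | cons p Q ih =>
    simp only [Multiset.map_cons, totalEdges_cons_path, Multiset.map_add, ih, pathEdges_map]

theorem totalVerts_map (f : V → U) (Q C : Multiset (List V)) :
    totalVerts (Q.map (List.map f)) (C.map (List.map f)) = (totalVerts Q C).map f := by
  induction Q using Multiset.induction with
  | empty =>
    induction C using Multiset.induction with
    | empty => simp [totalVerts]
    | cons c C ih =>
      simp only [Multiset.map_zero] at ih
      simp only [Multiset.map_cons, Multiset.map_zero, totalVerts_cons_cycle, Multiset.map_add, ih,
        Multiset.map_coe]
  | cons p Q ih =>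
    simp only [Multiset.map_cons, totalVerts_cons_path, Multiset.map_add, ih, Multiset.map_coe]

theorem mem_totalEdges {Q C : Multiset (List V)} {e : Sym2 V} : e ∈ totalEdges Q C ↔
    (∃ p ∈ Q, e ∈ pathEdges p) ∨ ∃ c ∈ C, e ∈ cycleEdges c := by
  have h : ∀ S : Multiset (Multiset (Sym2 V)), e ∈ S.sum ↔ ∃ s ∈ S, e ∈ s := fun S =>
    Multiset.mem_join
  simp [totalEdges, h]

theorem mem_totalVerts {Q C : Multiset (List V)} {v : V} : v ∈ totalVerts Q C ↔
    (∃ p ∈ Q, v ∈ p) ∨ ∃ c ∈ C, v ∈ c := by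
  have h : ∀ S : Multiset (Multiset V), v ∈ S.sum ↔ ∃ s ∈ S, v ∈ s := fun S => Multiset.mem_join
  simp [totalVerts, h]

theorem exists_mem_pathEdges {p : List V} (hp : 2 ≤ p.length) : ∃ e, e ∈ pathEdges p := by
  match p, hp with
  | a :: b :: l, _ => exact ⟨s(a, b), by simp⟩

variable [DecidableEq U] [DecidableEq V]

theorem ledger_map [Finite V] {G : SimpleGraph V} [Fintype G.edgeSet] {f : V → U}
    (hf : f.Injective) {Q C : Multiset (List V)} {k : ℕ} (hE : totalEdges Q C = G.edgeFinset.val)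
    (hk : ∀ v, (totalVerts Q C).count v ≤ k) :
    Ledger G k (Set.range f) (Sym2.map f '' G.edgeSet)
      (totalEdges (Q.map (List.map f)) (C.map (List.map f)))
      (totalVerts (Q.map (List.map f)) (C.map (List.map f))) where
  isSubdivision := by
    refine IsSubdivision.iso IsSubdivision.refl ⟨Equiv.ofInjective f hf, fun {a b} => ?_⟩
    have h1 : s(f a, f b) ∈ Sym2.map f '' G.edgeSet ↔ G.Adj a b := by
      rw [← Sym2.map_mk, (Sym2.map.injective hf).mem_set_image, SimpleGraph.mem_edgeSet]
    exact ⟨fun h => h1.1 h.2, fun h =>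
      ⟨fun h' => h.ne ((Equiv.ofInjective f hf).injective h'), h1.2 h⟩⟩
  finite := Set.finite_range f
  mem_of_mem_edges e he v hv := by
    rw [totalEdges_map] at he
    obtain ⟨e, -, rfl⟩ := Multiset.mem_map.1 he
    obtain ⟨w, -, rfl⟩ := Sym2.mem_map.1 hv
    exact ⟨w, rfl⟩
  mem_of_mem_verts v hv := by
    rw [totalVerts_map] at hv
    obtain ⟨w, -, rfl⟩ := Multiset.mem_map.1 hv
    exact ⟨w, rfl⟩
  not_isDiag := by
    rintro _ ⟨e, he, rfl⟩
    rw [Sym2.isDiag_map hf]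
    exact G.not_isDiag_of_mem_edgeSet he
  count_eq_one := by
    rintro _ ⟨e, he, rfl⟩
    rw [totalEdges_map, Multiset.count_map_eq_count' _ _ (Sym2.map.injective hf), hE]
    exact Multiset.count_eq_one_of_mem G.edgeFinset.nodup (by simpa using he)
  even_count e he := by
    rw [Multiset.count_eq_zero.2]
    · exact Even.zero
    · rw [totalEdges_map, hE]
      intro h
      obtain ⟨e, he', rfl⟩ := Multiset.mem_map.1 h
      exact he ⟨e, by simpa using he', rfl⟩
  count_le v := by
    rw [totalVerts_map]
    by_cases hv : v ∈ Set.range f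
    · obtain ⟨w, rfl⟩ := hv
      rw [Multiset.count_map_eq_count' _ _ hf]
      exact hk w
    · rw [Multiset.count_eq_zero.2]
      · exact Nat.zero_le _
      · intro h
        obtain ⟨w, -, rfl⟩ := Multiset.mem_map.1 h
        exact hv ⟨w, rfl⟩

omit [DecidableEq U] [DecidableEq V] in
theorem admissible_map {G : SimpleGraph V} [Fintype G.edgeSet] {f : V → U} (hf : f.Injective)
    {Q C : Multiset (List V)} (hE : totalEdges Q C = G.edgeFinset.val)
    (hQ : ∀ p ∈ Q, p.Nodup ∧ 2 ≤ p.length) (hC : ∀ c ∈ C, c.Nodup ∧ 3 ≤ c.length) :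
    Admissible (Sym2.map f '' G.edgeSet) (Q.map (List.map f)) (C.map (List.map f)) := by
  have key : ∀ e ∈ totalEdges Q C, Sym2.map f e ∈ Sym2.map f '' G.edgeSet := fun e he =>
    ⟨e, by rw [hE] at he; simpa using he, rfl⟩
  refine ⟨?_, ?_, ?_, ?_, ?_⟩ <;> intro l' hl' <;> obtain ⟨l, hl, rfl⟩ := Multiset.mem_map.1 hl'
  · exact (hQ l hl).1.map hf
  · obtain ⟨e, he⟩ := exists_mem_pathEdges (hQ l hl).2
    exact ⟨Sym2.map f e, by rw [pathEdges_map]; exact Multiset.mem_map_of_mem _ he,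
      key e (mem_totalEdges.2 (Or.inl ⟨l, hl, he⟩))⟩
  · exact (hC l hl).1.map hf
  · have := (hC l hl).2
    rintro h
    rw [List.map_eq_nil_iff] at h
    simp [h] at this
  · intro e he'
    rw [cycleEdges_map] at he'
    obtain ⟨e, he, rfl⟩ := Multiset.mem_map.1 he'
    exact key e (mem_totalEdges.2 (Or.inr ⟨l, hl, he⟩))

/-- A decomposition into paths only is a path odd-cover. -/
theorem exists_cover_of_paths [Finite V] {G : SimpleGraph V} [Fintype G.edgeSet]
    {Q : Multiset (List V)} (hE : totalEdges Q 0 = G.edgeFinset.val)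
    (hQ : ∀ p ∈ Q, p.Nodup ∧ 2 ≤ p.length) :
    ∃ (W : Type u) (H : SimpleGraph W), IsSubdivision G H ∧
      ∃ P : Fin Q.card → CompletePath W, IsPathOddCover H P := by
  -- No subdivision is needed, so a trivial multiplicity bound will do.
  have L := ledger_map (U := V) Function.injective_id hE (k := (totalVerts Q 0).card)
    (fun v => Multiset.count_le_card _ _)
  exact exists_isPathOddCover_of_ledger (by simp) L
    (admissible_map Function.injective_id hE hQ (by simp))

theorem exists_cover_of_paths_and_cycles [Finite V] {G : SimpleGraph V} [Fintype G.edgeSet]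
    {Q C : Multiset (List V)} {k : ℕ} (hk : 2 ≤ k) (hE : totalEdges Q C = G.edgeFinset.val)
    (hQ : ∀ p ∈ Q, p.Nodup ∧ 2 ≤ p.length) (hC : ∀ c ∈ C, c.Nodup ∧ 3 ≤ c.length)
    (hQk : Q.card ≤ k) (hv : ∀ v, (totalVerts Q C).count v ≤ k) (h0 : Q ≠ 0 ∨ C ≠ 0) :
    ∃ (W : Type u) (H : SimpleGraph W), IsSubdivision G H ∧
      ∃ P : Fin k → CompletePath W, IsPathOddCover H P := by
  -- The second summand is an infinite supply of subdivision vertices in the same universe.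
  have hf : Function.Injective (Sum.inl : V → V ⊕ ULift.{u} ℕ) := Sum.inl_injective
  obtain ⟨X, h, Q', hQ', L, R⟩ := exists_paths hk (by simpa using hQk) (by simpa using h0)
    (ledger_map hf hE hv) (admissible_map hf hE hQ hC)
  exact exists_isPathOddCover_of_ledger hQ' L R

end Initial

/-! ### The excluded graphs -/

section Components

variable {V : Type u} {G : SimpleGraph V}

theorem isChain_of_pathEdges : ∀ {l : List V}, (∀ e ∈ pathEdges l, e ∈ G.edgeSet) →
    l.IsChain G.Adj
  | [], _ => List.isChain_nil
  | [_], _ => List.isChain_singleton _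
  | a :: b :: l, h => List.isChain_cons_cons.2 ⟨h s(a, b) (by simp),
      isChain_of_pathEdges fun e he => h e (by simp [he])⟩

theorem exists_walk_of_isChain {l : List V} (hl : l ≠ []) (h : l.IsChain G.Adj) :
    ∃ (a b : V) (p : G.Walk a b), p.support = l :=
  ⟨_, _, _, SimpleGraph.Walk.support_ofSupport hl h⟩

/-- A walk that uses all edges at its vertices cannot be left, so it fills its component. -/
theorem toSubgraph_eq_induce_supp {a b : V} (p : G.Walk a b)
    (H : ∀ u ∈ p.support, ∀ v, G.Adj u v → s(u, v) ∈ p.edges) {w : V} (hw : w ∈ p.support) :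
    p.toSubgraph = (⊤ : G.Subgraph).induce (G.connectedComponentMk w).supp := by
  classical
  have hreach : ∀ x y, G.Reachable x y → x ∈ p.support → y ∈ p.support := by
    rintro x y ⟨q⟩ hx
    induction q with
    | nil => exact hx
    | cons hadj q ih => exact ih (p.snd_mem_support_of_mem_edges (H _ hx _ hadj))
  have hsupp : ∀ x, x ∈ p.support ↔ x ∈ (G.connectedComponentMk w).supp := by
    intro x
    rw [SimpleGraph.ConnectedComponent.mem_supp_iff, SimpleGraph.ConnectedComponent.eq]
    exact ⟨fun hx => (p.takeUntil x hx).reachable.symm.trans (p.takeUntil w hw).reachable,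
      fun hx => hreach w x hx.symm hw⟩
  refine SimpleGraph.Subgraph.ext ?_ ?_
  · ext x
    simpa using hsupp x
  · ext x y
    rw [SimpleGraph.Walk.adj_toSubgraph_iff_mem_edges]
    simp only [SimpleGraph.Subgraph.induce_adj, SimpleGraph.Subgraph.top_adj, ← hsupp]
    exact ⟨fun h => ⟨p.fst_mem_support_of_mem_edges h, p.snd_mem_support_of_mem_edges h,
      p.adj_of_mem_edges h⟩, fun h => H x h.1 y h.2.2⟩

theorem degree_eq_one_of_path_component {a b : V} [Fintype (G.neighborSet a)] {p : G.Walk a b}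
    (hp : p.IsPath) (hnil : ¬ p.Nil) {c : G.ConnectedComponent}
    (h : p.toSubgraph = (⊤ : G.Subgraph).induce c.supp) : G.degree a = 1 := by
  have ha : a ∈ c.supp := by
    have : a ∈ p.toSubgraph.verts := by simp
    rwa [h] at this
  rw [SimpleGraph.degree_eq_one_iff_existsUnique_adj]
  have h1 := hp.neighborSet_toSubgraph_startpoint hnil
  refine ⟨p.snd, p.adj_snd hnil, fun w hw => ?_⟩
  have : w ∈ p.toSubgraph.neighborSet a := by
    rw [SimpleGraph.Subgraph.mem_neighborSet, h]
    refine ⟨ha, ?_, hw⟩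
    rw [SimpleGraph.ConnectedComponent.mem_supp_iff] at ha ⊢
    rw [← ha, SimpleGraph.ConnectedComponent.eq]
    exact hw.symm.reachable
  rwa [h1] at this

theorem exists_odd_pair_of_isPathComponent [Fintype V] [DecidableRel G.Adj]
    {c : G.ConnectedComponent} (hc : IsPathComponent c) (hn : c.supp.Nontrivial) :
    ∃ a b, a ≠ b ∧ a ∈ c.supp ∧ b ∈ c.supp ∧ Odd (G.degree a) ∧ Odd (G.degree b) := by
  obtain ⟨a, b, p, hp, h⟩ := hc
  have hv : ∀ x, x ∈ p.support ↔ x ∈ c.supp := fun x => by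
    rw [← SimpleGraph.Walk.mem_verts_toSubgraph, h]
    rfl
  have hnil : ¬ p.Nil := by
    intro hnil
    obtain ⟨x, hx, y, hy, hxy⟩ := hn
    rw [← hv, SimpleGraph.Walk.nil_iff_support_eq.1 hnil, List.mem_singleton] at hx hy
    exact hxy (hx.trans hy.symm)
  refine ⟨a, b, ?_, (hv a).1 (by simp), (hv b).1 (by simp), ?_, ?_⟩
  · rintro rfl
    exact hnil (SimpleGraph.Walk.isPath_iff_nil.1 hp)
  · rw [degree_eq_one_of_path_component hp hnil h]; exact odd_one
  · rw [degree_eq_one_of_path_component hp.reverse (by simpa using hnil)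
      (p.toSubgraph_reverse.trans h)]
    exact odd_one

theorem mem_totalVerts_of_mem_totalEdges {Q C : Multiset (List V)} {e : Sym2 V} {v : V}
    (he : e ∈ totalEdges Q C) (hv : v ∈ e) : v ∈ totalVerts Q C := by
  rw [mem_totalVerts]
  rcases mem_totalEdges.1 he with ⟨p, hp, he⟩ | ⟨c, hc, he⟩
  · exact Or.inl ⟨p, hp, mem_of_mem_pathEdges he hv⟩
  · refine Or.inr ⟨c, hc, ?_⟩
    cases c with
    | nil => simp [cycleEdges] at he
    | cons a l => simpa [or_comm, or_assoc] using mem_of_mem_pathEdges he hv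

/-- This is the case `k ≤ 1`. The members are vertex-disjoint, so each is a whole component, and
every remaining vertex is isolated. -/
theorem isCyclesWithAtMostOnePath_of_decomposition [Fintype V] [DecidableEq V]
    [DecidableRel G.Adj] {Q C : Multiset (List V)} (hE : totalEdges Q C = G.edgeFinset.val)
    (hQ : ∀ p ∈ Q, p.Nodup ∧ 2 ≤ p.length) (hC : ∀ c ∈ C, c.Nodup ∧ 3 ≤ c.length)
    (hv : ∀ v, (totalVerts Q C).count v ≤ 1) (hodd : oddDegreeCount G ≤ 2) (hC0 : C ≠ 0) :
    IsCyclesWithAtMostOnePath G := by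
  have hmem : ∀ e, e ∈ totalEdges Q C ↔ e ∈ G.edgeSet := fun e => by rw [hE]; simp
  have hcyc : ∀ c ∈ C, ∀ v ∈ c, IsCycleComponent (G.connectedComponentMk v) := by
    intro c hc v hvc
    obtain ⟨C, rfl⟩ := Multiset.exists_cons_of_mem hc
    obtain ⟨hcn, hcl⟩ := hC c hc
    obtain ⟨x, l, rfl⟩ := List.exists_cons_of_ne_nil (l := c) (by rintro rfl; simp at hcl)
    rw [totalEdges_cons_cycle] at hE hmem
    obtain ⟨a, b, p, hp⟩ := exists_walk_of_isChain (G := G) (l := x :: (l ++ [x])) (by simp)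
      (isChain_of_pathEdges fun e he => (hmem e).1 (Multiset.mem_add.2 (Or.inl he)))
    have hedges : (p.edges : Multiset (Sym2 V)) = cycleEdges (x :: l) := by
      rw [← pathEdges_support, hp]; rfl
    obtain rfl : a = x := by
      have := p.cons_tail_support
      rw [hp] at this
      simpa using this
    obtain rfl : a = b := by
      have := p.getLast_support
      simp only [hp] at this
      simpa using this
    refine ⟨a, p, ?_, toSubgraph_eq_induce_supp p ?_ (by rw [hp]; simp at hvc ⊢; tauto)⟩
    · rw [SimpleGraph.Walk.isCycle_def, SimpleGraph.Walk.isTrail_def, hp]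
      refine ⟨?_, ?_, ?_⟩
      · rw [← Multiset.coe_nodup, hedges]
        exact Multiset.nodup_of_le (hE ▸ Multiset.le_add_right _ _) G.edgeFinset.nodup
      · rintro rfl
        simp at hp
      · simpa using (List.perm_append_singleton a l).nodup_iff.2 hcn
    · intro u hu w huw
      have hu : u ∈ a :: l := by rw [hp] at hu; simp at hu ⊢; tauto
      have := (hmem s(u, w)).2 huw
      rw [Multiset.mem_add, ← hedges, Multiset.mem_coe] at this
      -- An edge at `u` from another member would put `u` on two members.
      refine this.resolve_right fun he => ?_
      have h1 := hv u
      have h2 := Multiset.count_pos.2 (mem_totalVerts_of_mem_totalEdges he (v := u) (by simp))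
      have h3 : 0 < ((a :: l : List V) : Multiset V).count u := Multiset.count_pos.2 hu
      rw [totalVerts_cons_cycle, Multiset.count_add] at h1
      omega
  have hpath : ∀ p ∈ Q, ∀ v ∈ p, IsPathComponent (G.connectedComponentMk v) := by
    intro c hc v hvc
    obtain ⟨Q, rfl⟩ := Multiset.exists_cons_of_mem hc
    obtain ⟨hcn, hcl⟩ := hQ c hc
    rw [totalEdges_cons_path] at hE hmem
    obtain ⟨a, b, p, hp⟩ := exists_walk_of_isChain (G := G) (l := c) (by rintro rfl; simp at hcl)
      (isChain_of_pathEdges fun e he => (hmem e).1 (Multiset.mem_add.2 (Or.inl he)))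
    have hedges : (p.edges : Multiset (Sym2 V)) = pathEdges c := by
      rw [← pathEdges_support, hp]
    refine ⟨a, b, p, ?_, toSubgraph_eq_induce_supp p ?_ (hp ▸ hvc)⟩
    · rwa [SimpleGraph.Walk.isPath_def, hp]
    · intro u hu w huw
      rw [hp] at hu
      have := (hmem s(u, w)).2 huw
      rw [Multiset.mem_add, ← hedges, Multiset.mem_coe] at this
      refine this.resolve_right fun he => ?_
      have h1 := hv u
      have h2 := Multiset.count_pos.2 (mem_totalVerts_of_mem_totalEdges he (v := u) (by simp))
      have h3 : 0 < (c : Multiset V).count u := Multiset.count_pos.2 hu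
      rw [totalVerts_cons_path, Multiset.count_add] at h1
      omega
  refine ⟨?_, ?_, ?_⟩
  · obtain ⟨c, hc⟩ := Multiset.exists_mem_of_ne_zero hC0
    obtain ⟨v, hvc⟩ := List.exists_mem_of_ne_nil c (by
      rintro rfl
      simpa using (hC _ hc).2)
    exact ⟨_, hcyc c hc v hvc⟩
  · intro c
    induction c using SimpleGraph.ConnectedComponent.ind with
    | h v =>
      by_cases hvT : v ∈ totalVerts Q C
      · rcases mem_totalVerts.1 hvT with ⟨p, hp, hvp⟩ | ⟨c, hc, hvc⟩
        · exact Or.inr (hpath p hp v hvp)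
        · exact Or.inl (hcyc c hc v hvc)
      · refine Or.inr ⟨v, v, SimpleGraph.Walk.nil, SimpleGraph.Walk.IsPath.nil,
          toSubgraph_eq_induce_supp _ ?_ (by simp)⟩
        intro u hu w huw
        rw [SimpleGraph.Walk.support_nil, List.mem_singleton] at hu
        subst hu
        exact absurd (mem_totalVerts_of_mem_totalEdges ((hmem s(u, w)).2 huw) (by simp)) hvT
  · rintro c₁ ⟨h₁, n₁⟩ c₂ ⟨h₂, n₂⟩
    by_contra hne
    obtain ⟨a₁, b₁, hab₁, ha₁, hb₁, oa₁, ob₁⟩ := exists_odd_pair_of_isPathComponent h₁ n₁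
    obtain ⟨a₂, b₂, hab₂, ha₂, hb₂, oa₂, ob₂⟩ := exists_odd_pair_of_isPathComponent h₂ n₂
    have hdisj : ∀ x ∈ c₁.supp, ∀ y ∈ c₂.supp, x ≠ y := by
      rintro x hx _ hy rfl
      exact hne (hx.symm.trans hy)
    -- Two nontrivial path components would give four odd vertices.
    have hsub : ({a₁, b₁, a₂, b₂} : Finset V) ⊆ Finset.univ.filter fun v => Odd (G.degree v) := by
      intro x hx
      simp only [Finset.mem_insert, Finset.mem_singleton] at hx
      rcases hx with rfl | rfl | rfl | rfl <;> simpa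
    have hcard := Finset.card_le_card hsub
    rw [Finset.card_insert_of_notMem (by
        simp [hab₁, hdisj a₁ ha₁ a₂ ha₂, hdisj a₁ ha₁ b₂ hb₂]),
      Finset.card_insert_of_notMem (by simp [hdisj b₁ hb₁ a₂ ha₂, hdisj b₁ hb₁ b₂ hb₂]),
      Finset.card_pair hab₂] at hcard
    change _ ≤ oddDegreeCount G at hcard
    omega

end Components

/-! ### The lower bound -/

section LowerBound

variable {V W : Type u}

theorem countP_edges [DecidableEq W] {a b : W} (p : (⊤ : SimpleGraph W).Walk a b) (v : W) :
    (p.edges : Multiset (Sym2 W)).countP (v ∈ ·) + (if v = a then 1 else 0) +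
      (if v = b then 1 else 0) = 2 * p.support.count v := by
  rw [← pathEdges_support]
  have hc : p.support.IsChain (· ≠ ·) := p.isChain_adj_support.imp fun _ _ h => h.ne
  have h := countP_pathEdges v a p.support.tail (by rw [p.cons_tail_support]; exact hc)
  simp only [SimpleGraph.Walk.cons_tail_support, SimpleGraph.Walk.getLast_support] at h
  exact h

/-- The degree is the sum of the counts at `v` reduced modulo 2, while the incidence count is the
unreduced sum. -/
theorem exists_sum_countP [Fintype W] [DecidableEq W] (H : SimpleGraph W) [DecidableRel H.Adj]
    {E : Multiset (Sym2 W)} (hE : ∀ e, e ∈ H.edgeSet ↔ Odd (E.count e)) (v : W) :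
    H.degree v ≤ E.countP (v ∈ ·) ∧ (Odd (H.degree v) ↔ Odd (E.countP (v ∈ ·))) := by
  have h1 : E.countP (v ∈ ·) = ∑ e ∈ Finset.univ.filter (v ∈ ·), E.count e := by
    rw [Multiset.countP_eq_card_filter, ← Multiset.sum_count_eq_card
      (s := Finset.univ.filter (v ∈ ·)) (by simp)]
    refine Finset.sum_congr rfl fun e he => ?_
    rw [Multiset.count_filter_of_pos (by simpa using he)]
  have h2 : H.degree v = ∑ e ∈ Finset.univ.filter (v ∈ ·), E.count e % 2 := by
    rw [← H.card_incidenceFinset_eq_degree, H.incidenceFinset_eq_filter, Finset.card_eq_sum_ones,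
      Finset.sum_filter, Finset.sum_filter, ← Finset.sum_subset (Finset.subset_univ H.edgeFinset)]
    · refine Finset.sum_congr rfl fun e he => ?_
      rw [Nat.odd_iff.1 ((hE e).1 (by simpa using he))]
    · intro e _ he
      have : ¬ Odd (E.count e) := fun h => he (by simpa using (hE e).2 h)
      rw [Nat.odd_iff] at this
      simp; intro; omega
  refine ⟨?_, ?_⟩
  · rw [h1, h2]
    exact Finset.sum_le_sum fun e _ => Nat.mod_le _ _
  · rw [Nat.odd_iff, Nat.odd_iff, h1, h2, ← Finset.sum_nat_mod]

theorem bounds_of_isPathOddCover [Fintype W] [DecidableEq W] {H : SimpleGraph W}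
    [DecidableRel H.Adj] {k : ℕ} {P : Fin k → CompletePath W} (hP : IsPathOddCover H P) :
    (∀ v, H.degree v ≤ 2 * k) ∧ (Finset.univ.filter fun v => Odd (H.degree v)).card ≤ 2 * k := by
  let E : Multiset (Sym2 W) := ∑ i, ((P i).walk.edges : Multiset (Sym2 W))
  have hE : ∀ e, e ∈ H.edgeSet ↔ Odd (E.count e) := fun e => by
    rw [hP e, ncard_mem_edges, Multiset.count_sum']
  have hc : ∀ v, E.countP (v ∈ ·) =
      ∑ i, ((P i).walk.edges : Multiset (Sym2 W)).countP (v ∈ ·) := fun v => by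
    exact map_sum (Multiset.countPAddMonoidHom (v ∈ ·)) _ _
  have hs : ∀ i v, (P i).walk.support.count v ≤ 1 := fun i v =>
    List.nodup_iff_count_le_one.1 ((P i).walk.isPath_def.1 (P i).isPath) v
  constructor
  · intro v
    refine (exists_sum_countP H hE v).1.trans ?_
    rw [hc]
    calc _ ≤ ∑ i : Fin k, 2 := Finset.sum_le_sum fun i _ => by
          have := countP_edges (P i).walk v
          have := hs i v
          omega
      _ = 2 * k := by simp [mul_comm]
  · have hsub : (Finset.univ.filter fun v => Odd (H.degree v)) ⊆
        Finset.univ.image (fun i => (P i).fst) ∪ Finset.univ.image (fun i => (P i).lst) := by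
      intro v hv
      have hv := (exists_sum_countP H hE v).2.1 (Finset.mem_filter.1 hv).2
      by_contra hn
      simp only [Finset.mem_union, Finset.mem_image, Finset.mem_univ, true_and, not_or,
        not_exists] at hn
      refine Nat.not_even_iff_odd.2 hv ?_
      rw [hc]
      refine Finset.even_sum _ fun i _ => ?_
      have := countP_edges (P i).walk v
      rw [if_neg (Ne.symm (hn.1 i)), if_neg (Ne.symm (hn.2 i))] at this
      exact ⟨_, by rw [← two_mul, ← this]; rfl⟩
    refine (Finset.card_le_card hsub).trans ((Finset.card_union_le _ _).trans ?_)
    have h1 := Finset.card_image_le (s := (Finset.univ : Finset (Fin k))) (f := fun i => (P i).fst)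
    have h2 := Finset.card_image_le (s := (Finset.univ : Finset (Fin k))) (f := fun i => (P i).lst)
    simp at h1 h2
    omega

/-- At an end of the subdivided edge the new vertex takes the place of the other end; elsewhere the
neighbours are unchanged. -/
theorem ncard_neighborSet_subdivideEdge (H : SimpleGraph W) (u v a : W) (huv : H.Adj u v) :
    ((subdivideEdge H u v).neighborSet (some a)).ncard = (H.neighborSet a).ncard := by
  classical
  have : (subdivideEdge H u v).neighborSet (some a) =
      (fun b => if s(a, b) = s(u, v) then none else some b) '' H.neighborSet a := by
    ext (_ | b)
    · simp only [SimpleGraph.mem_neighborSet, subdivideEdge, Set.mem_image]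
      constructor
      · rintro (rfl | rfl)
        · exact ⟨v, huv, by simp⟩
        · exact ⟨u, huv.symm, by simp [Sym2.eq_swap]⟩
      · rintro ⟨b, -, hb⟩
        have : s(a, b) = s(u, v) := by
          by_contra h
          simp [h] at hb
        grind [Sym2.eq_iff]
    · simp only [SimpleGraph.mem_neighborSet, subdivideEdge, Set.mem_image]
      constructor
      · rintro ⟨h1, h2⟩
        exact ⟨b, h1, by simp [h2]⟩
      · rintro ⟨b', h1, h2⟩
        by_cases h : s(a, b') = s(u, v)
        · simp [h] at h2
        · rw [if_neg h, Option.some.injEq] at h2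
          subst h2
          exact ⟨h1, h⟩
  rw [this, Set.InjOn.ncard_image]
  intro b hb b' hb' h
  by_cases h1 : s(a, b) = s(u, v) <;> by_cases h2 : s(a, b') = s(u, v) <;> simp [h1, h2] at h
  · grind [Sym2.eq_iff]
  · exact h

theorem neighborSet_subdivideEdge_none (H : SimpleGraph W) (u v : W) :
    (subdivideEdge H u v).neighborSet none = some '' {u, v} := by
  ext (_ | b) <;> simp [subdivideEdge, eq_comm]

theorem IsSubdivision.degrees [Finite V] {G : SimpleGraph V} {H : SimpleGraph W}
    (hS : IsSubdivision G H) : Finite W ∧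
      {w | Odd (H.neighborSet w).ncard}.ncard = {v | Odd (G.neighborSet v).ncard}.ncard ∧
      ∀ v, ∃ w, (H.neighborSet w).ncard = (G.neighborSet v).ncard := by
  induction hS with
  | refl => exact ⟨inferInstance, rfl, fun v => ⟨v, rfl⟩⟩
  | @subdivide W H u v hS huv ih =>
    obtain ⟨h1, h2, h3⟩ := ih
    refine ⟨inferInstance, ?_, fun x => ?_⟩
    · rw [← h2, ← Set.ncard_image_of_injective _ (Option.some_injective W)]
      congr 1
      ext (_ | a)
      · simp only [Set.mem_ofPred_eq, neighborSet_subdivideEdge_none,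
          Set.ncard_image_of_injective _ (Option.some_injective W), Set.ncard_pair huv.ne]
        simp
      · simp [ncard_neighborSet_subdivideEdge H u v a huv]
    · obtain ⟨w, hw⟩ := h3 x
      exact ⟨some w, by rw [ncard_neighborSet_subdivideEdge H u v w huv, hw]⟩
  | @iso W W' H H' hS f ih =>
    obtain ⟨h1, h2, h3⟩ := ih
    have key : ∀ w, (H'.neighborSet (f w)).ncard = (H.neighborSet w).ncard := by
      intro w
      have : H'.neighborSet (f w) = f '' H.neighborSet w := by
        ext x
        obtain ⟨x, rfl⟩ := f.surjective x
        simp [f.map_adj_iff]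
      rw [this, Set.ncard_image_of_injective _ f.injective]
    refine ⟨Finite.of_equiv W f.toEquiv, ?_, fun x => ?_⟩
    · rw [← h2, ← Set.ncard_image_of_injective _ f.injective]
      congr 1
      ext x
      obtain ⟨x, rfl⟩ := f.surjective x
      simp [key]
    · obtain ⟨w, hw⟩ := h3 x
      exact ⟨f w, by rw [key, hw]⟩

theorem IsSubdivision.le_two_mul_pathOddCoverNumber [Fintype V] {G : SimpleGraph V}
    [DecidableRel G.Adj] {H : SimpleGraph W} (hS : IsSubdivision G H) :
    oddDegreeCount G ≤ 2 * pathOddCoverNumber H ∧ G.maxDegree ≤ 2 * pathOddCoverNumber H := by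
  classical
  obtain ⟨hfin, hodd, hdeg⟩ := hS.degrees
  have := Fintype.ofFinite W
  obtain ⟨P, hP⟩ : pathOddCoverNumber H ∈
      {k : ℕ | ∃ P : Fin k → CompletePath W, IsPathOddCover H P} :=
    Nat.sInf_mem (exists_isPathOddCover H)
  obtain ⟨h1, h2⟩ := bounds_of_isPathOddCover hP
  have hG : ∀ v, (G.neighborSet v).ncard = G.degree v := fun v => by
    rw [Set.ncard_eq_toFinset_card']; rfl
  have hH : ∀ v, (H.neighborSet v).ncard = H.degree v := fun v => by
    rw [Set.ncard_eq_toFinset_card']; rfl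
  constructor
  · refine le_trans (le_of_eq ?_) h2
    simp only [hG, hH] at hodd
    rw [oddDegreeCount, ← Set.ncard_coe_finset, ← Set.ncard_coe_finset]
    simpa using hodd.symm
  · refine G.maxDegree_le_of_forall_degree_le _ fun v => ?_
    obtain ⟨w, hw⟩ := hdeg v
    rw [← hG, ← hw, hH]
    exact h1 w

end LowerBound

/-! ### The upper bound and the theorem -/

section Main

variable {V : Type u}

theorem exists_subdivision_cover [Fintype V] {G : SimpleGraph V} [DecidableRel G.Adj]
    (hG : ¬ IsCyclesWithAtMostOnePath G) {k : ℕ} (hodd : oddDegreeCount G ≤ 2 * k)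
    (hdeg : G.maxDegree ≤ 2 * k) :
    ∃ (j : ℕ) (W : Type u) (H : SimpleGraph W), j ≤ k ∧ IsSubdivision G H ∧
      ∃ P : Fin j → CompletePath W, IsPathOddCover H P := by
  classical
  obtain ⟨Q, C, hQ, hC, hE, hQc, hv⟩ := exists_path_cycle_decomposition G
  have hvk : ∀ v, (totalVerts Q C).count v ≤ k := by
    intro v
    have h1 := hv v
    have h2 := (G.degree_le_maxDegree v).trans hdeg
    split_ifs at h1 with h
    · obtain ⟨m, hm⟩ := h
      omega
    · omega
  by_cases hC0 : C = 0
  · subst hC0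
    obtain ⟨W, H, hS, hP⟩ := exists_cover_of_paths hE hQ
    exact ⟨_, W, H, by omega, hS, hP⟩
  · rcases Nat.lt_or_ge k 2 with hk | hk
    -- The hypothesis on `G` serves only to rule out `k ≤ 1` in the presence of a cycle.
    · exact absurd (isCyclesWithAtMostOnePath_of_decomposition hE hQ hC
        (fun v => (hvk v).trans (by omega)) (by omega) hC0) hG
    · obtain ⟨W, H, hS, hP⟩ := exists_cover_of_paths_and_cycles hk hE hQ hC (by omega) hvk
        (Or.inr hC0)
      exact ⟨_, W, H, le_rfl, hS, hP⟩

end Main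

theorem mainTheorem2 {V : Type u} [Fintype V] (G : SimpleGraph V) [DecidableRel G.Adj]
    (hG : ¬ IsCyclesWithAtMostOnePath G) :
    IsLeast
      {x : ℚ | ∃ (W : Type u) (H : SimpleGraph W),
        IsSubdivision G H ∧ x = (pathOddCoverNumber H : ℚ)}
      (max ((oddDegreeCount G : ℚ) / 2) (⌈(G.maxDegree : ℚ) / 2⌉ : ℚ)) := by
  obtain ⟨m, hm⟩ : Even (oddDegreeCount G) := G.even_card_odd_degree_vertices
  have hceil : ∀ n : ℕ, ⌈(G.maxDegree : ℚ) / 2⌉ ≤ (n : ℤ) ↔ G.maxDegree ≤ 2 * n := fun n => by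
    rw [Int.ceil_le, div_le_iff₀ two_pos, mul_comm]
    norm_cast
  obtain ⟨d, hd⟩ : ∃ d : ℕ, ⌈(G.maxDegree : ℚ) / 2⌉ = d :=
    ⟨_, (Int.toNat_of_nonneg (Int.ceil_nonneg (by positivity))).symm⟩
  have hmax : max ((oddDegreeCount G : ℚ) / 2) (⌈(G.maxDegree : ℚ) / 2⌉ : ℚ) =
      ((max m d : ℕ) : ℚ) := by
    rw [hd, hm, Nat.cast_max]
    push_cast
    congr 1
    ring
  -- This turns the rational maximum into the two integer inequalities that both bounds use.
  have hle : ∀ n, max m d ≤ n ↔ oddDegreeCount G ≤ 2 * n ∧ G.maxDegree ≤ 2 * n := fun n => by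
    rw [← hceil, hd, hm, Nat.cast_le, max_le_iff]
    omega
  rw [hmax]
  have hlower : ∀ (W : Type u) (H : SimpleGraph W), IsSubdivision G H →
      max m d ≤ pathOddCoverNumber H := fun W H hS =>
    (hle _).2 hS.le_two_mul_pathOddCoverNumber
  constructor
  · obtain ⟨h1, h2⟩ := (hle _).1 le_rfl
    obtain ⟨j, W, H, hj, hS, P, hP⟩ := exists_subdivision_cover hG h1 h2
    have hupper : pathOddCoverNumber H ≤ j := Nat.sInf_le ⟨P, hP⟩
    exact ⟨W, H, hS, by rw [le_antisymm (hlower W H hS) (hupper.trans hj)]⟩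
  · rintro x ⟨W, H, hS, rfl⟩
    exact_mod_cast hlower W H hS
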